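/- \textbf{Setting.} Let $M$ sensors have real positions $u_1,\dots,u_M$, and let $a(\omega)=(e^{ju_1\omega},\dots,e^{ju_M\omega})^{\intercal}$. Let $f\ge 0$ be an integrable power density on $\mathbb R$, let $\sigma_\epsilon^2\ge 0$, and let $$R=\int a(\omega)a(\omega)^{H}f(\omega)\,d\omega+\sigma_\epsilon^2 I_M .$$ The measurements $x(1),x(2),\dots\in\mathbb C^M$ are i.i.d. zero-mean circular complex Gaussian vectors with covariance $R$ (so $\mathbb E[x x^{H}]=R$, $\mathbb E[x x^{\intercal}]=0$), and $\bar R_N=\frac1N\sum_{t=1}^N x(t)x(t)^{H}$. Let $D\ge 1$. For a parameter vector $\theta=(\omega_0,P,\nu_2,\dots,\nu_D,s)\in\mathbb R^{D+2}$ (with $s$ the modelled noise power) the covariance model is $$\widehat R(\theta)=a(\omega_0)a(\omega_0)^{H}\odot\Big(P\,U^{\circ 0}+\sum_{d=2}^{D}\nu_d\frac{j^d}{d!}U^{\circ d}+s I_M\Big),\qquad [U]_{k,l}=u_k-u_l ,$$ where $\odot$ is the entrywise product and $U^{\circ d}$ the entrywise $d$-th power. Fix a Hermitian positive definite weight matrix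 $W$, write $\|X\|_W=\|W^{1/2}XW^{1/2}\|_F$ (Frobenius norm), and put $$J_N(\theta)=\tfrac12\|\bar R_N-\widehat R(\theta)\|_W^2,\qquad J_\infty(\theta)=\tfrac12\|\widehat R(\theta)-R\|_W^2 .$$ Let $\omega_0$ range over a compact set $K\subset\mathbb R$ (the unambiguous angular domain) and the other parameters over $\mathbb R$. Let $\widehat\theta_N$ be a (measurable) minimizer of $J_N$ over this domain, almost surely, for each $N\ge1$. Assume that $J_\infty$ has a unique global minimizer $\theta_0$ over the domain, that the $\omega_0$-coordinate of $\theta_0$ is interior to $K$, and that the Hessian $H_\infty(\theta_0)$ of $J_\infty$ at $\theta_0$ is invertible. \textbf{Claim.} (1) For all $k,l$, $$[H_\infty(\theta_0)]_{k,l}=\operatorname{tr}\Big\{W\frac{\partial^2\widehat R(\theta_0)}{\partial\theta_k\partial\theta_l}W\big(\widehat R(\theta_0)-R\big)\Big\}+\operatorname{tr}\Big(W\frac{\partial\widehat R(\theta_0)}{\partial\theta_k}W\frac{\partial\widehat R(\theta_0)}{\partial\theta_l}\Big).$$ (2) For all $A,B\in\mathbb C^{M\times M}$, $\mathbb E\{x(t)^{H}Ax(t)\,x(t)^{H}Bx(t)\}=\operatorname{tr}(RA)\operatorname{tr}(RB)+\operatorname{tr}(RARB)$.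 (3) The limit $C_0=\lim_{N\to\infty}N\,\mathbb E[\nabla J_N(\theta_0)\nabla J_N(\theta_0)^{\intercal}]$ exists, and $$[C_0]_{k,l}=\operatorname{tr}\Big(W\frac{\partial\widehat R(\theta_0)}{\partial\theta_k}WRW\frac{\partial\widehat R(\theta_0)}{\partial\theta_l}WR\Big).$$ (4) The matrix $C_N=\mathbb E[(\widehat\theta_N-\theta_0)(\widehat\theta_N-\theta_0)^{\intercal}]$ is finite for every $N\ge1$, and $C_N\sim\frac1N H_\infty(\theta_0)^{-1}C_0H_\infty(\theta_0)^{-1}$, that is, $$\lim_{N\to\infty}N\,C_N=H_\infty(\theta_0)^{-1}C_0H_\infty(\theta_0)^{-1}.$$ (All expectations above are of integrable quantities.) -/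

import Mathlib

open MeasureTheory ProbabilityTheory Filter Topology
open scoped Matrix ComplexOrder

namespace MoMET

noncomputable section

/-- Labels of the coordinates of `θ = (ω₀, P, ν₂, …, ν_D, σ_ε²)`. -/
inductive Param (D : ℕ) where
  | omega : Param D
  | power : Param D
  | nu (d : Finset.Icc 2 D) : Param D
  | noise : Param D
deriving DecidableEq, Fintype

variable {M D : ℕ} {Ω : Type*}

/-- The steering vector `a(ω)`, with entries `exp (j u_k ω)`. -/
def steering (u : Fin M → ℝ) (ω : ℝ) : Fin M → ℂ :=
  fun k => Complex.exp (Complex.I * u k * ω)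

/-- The matrix `a(ω) a(ω)ᴴ`. -/
def steeringOuter (u : Fin M → ℝ) (ω : ℝ) : Matrix (Fin M) (Fin M) ℂ :=
  Matrix.vecMulVec (steering u ω) (star (steering u ω))

/-- The true covariance matrix `R = ∫ a(ω) a(ω)ᴴ f(ω) dω + σ_ε² I`. -/
def trueCov (u : Fin M → ℝ) (f : ℝ → ℝ) (σε : ℝ) : Matrix (Fin M) (Fin M) ℂ :=
  (Matrix.of fun k l => ∫ ω : ℝ, steeringOuter u ω k l * (f ω : ℂ)) +
    ((σε ^ 2 : ℝ) : ℂ) • (1 : Matrix (Fin M) (Fin M) ℂ)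

/-- The `d`-th Hadamard power of the geometry matrix `U`, with `U k l = u k - u l`. -/
def geomPow (u : Fin M → ℝ) (d : ℕ) : Matrix (Fin M) (Fin M) ℂ :=
  Matrix.of fun k l => (((u k - u l) ^ d : ℝ) : ℂ)

/-- `B̂(α) = P U^∘0 + ∑_{d=2}^D ν_d (j^d / d!) U^∘d + σ_ε² I`. -/
def shapeModel (u : Fin M → ℝ) (θ : Param D → ℝ) : Matrix (Fin M) (Fin M) ℂ :=
  (θ .power : ℂ) • geomPow u 0 +
    ∑ d : Finset.Icc 2 D,
      ((θ (.nu d) : ℂ) * (Complex.I ^ (d : ℕ) / (Nat.factorial d : ℂ))) • geomPow u d +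
    (θ .noise : ℂ) • (1 : Matrix (Fin M) (Fin M) ℂ)

/-- The moment-based covariance model `R̂(θ) = a(ω₀) a(ω₀)ᴴ ⊙ B̂(α)`. -/
def covModel (u : Fin M → ℝ) (θ : Param D → ℝ) : Matrix (Fin M) (Fin M) ℂ :=
  steeringOuter u (θ .omega) ⊙ shapeModel u θ

/-- The sample covariance matrix `R̄_N = N⁻¹ ∑_t x(t) x(t)ᴴ` of the first `N` samples. -/
def sampleCov (x : ℕ → Ω → Fin M → ℂ) (N : ℕ) (o : Ω) : Matrix (Fin M) (Fin M) ℂ :=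
  (N : ℂ)⁻¹ • ∑ t ∈ Finset.range N, Matrix.vecMulVec (x t o) (star (x t o))

/-- The squared weighted norm `‖X‖_W² = tr (W X W Xᴴ)`; see `weightedNormSq_eq` for its
expression as the squared Frobenius norm of `W^{1/2} X W^{1/2}`. -/
def weightedNormSq (W X : Matrix (Fin M) (Fin M) ℂ) : ℝ :=
  (W * X * W * Xᴴ).trace.re

/-- If `S` is a Hermitian square root of `W`, then `‖X‖_W` is the Frobenius norm of `S X S`. -/
theorem weightedNormSq_eq (S X : Matrix (Fin M) (Fin M) ℂ) (hS : S.IsHermitian) :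
    weightedNormSq (S * S) X = ∑ k, ∑ l, ‖(S * X * S) k l‖ ^ 2 := by
  have h1 : (S * S * X * (S * S) * Xᴴ).trace = ((S * X * S) * (S * X * S)ᴴ).trace := by
    rw [Matrix.conjTranspose_mul, Matrix.conjTranspose_mul, hS.eq]
    calc (S * S * X * (S * S) * Xᴴ).trace = (S * (S * X * S * S * Xᴴ)).trace := by
          simp only [Matrix.mul_assoc]
      _ = _ := by rw [Matrix.trace_mul_comm]; simp only [Matrix.mul_assoc]
  rw [weightedNormSq, h1]
  simp only [Matrix.trace, Matrix.diag_apply, Matrix.mul_apply (M := S * X * S),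
    Matrix.conjTranspose_apply, Complex.re_sum]
  refine Finset.sum_congr rfl fun k _ => Finset.sum_congr rfl fun l _ => ?_
  rw [Complex.star_def, Complex.mul_conj, Complex.ofReal_re, Complex.normSq_eq_norm_sq]

/-- The cost `θ ↦ ½ ‖C - R̂(θ)‖_W²` of fitting the model to the matrix `C`. It is `J_N` for
`C = R̄_N` and `J_∞` for `C = R`. -/
def cost (u : Fin M → ℝ) (W C : Matrix (Fin M) (Fin M) ℂ) (θ : Param D → ℝ) : ℝ :=
  (1 / 2 : ℝ) * weightedNormSq W (C - covModel u θ)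

/-- The partial derivative `∂F/∂θ_k`. -/
def partialDeriv {E : Type*} [NormedAddCommGroup E] [NormedSpace ℝ E] (k : Param D)
    (F : (Param D → ℝ) → E) (θ : Param D → ℝ) : E :=
  lineDeriv ℝ F θ (Pi.single k 1)

/-- The Hessian matrix of a real function of `θ`. -/
def hessian (F : (Param D → ℝ) → ℝ) (θ : Param D → ℝ) : Matrix (Param D) (Param D) ℝ :=
  Matrix.of fun k l => partialDeriv k (partialDeriv l F) θ

/-- The entrywise derivative `∂R̂/∂θ_k`. -/
def covModelD (u : Fin M → ℝ) (k : Param D) (θ : Param D → ℝ) : Matrix (Fin M) (Fin M) ℂ :=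
  Matrix.of fun m n => partialDeriv k (fun θ' => covModel u θ' m n) θ

/-- The entrywise second derivative `∂²R̂/∂θ_k∂θ_l`. -/
def covModelD2 (u : Fin M → ℝ) (k l : Param D) (θ : Param D → ℝ) :
    Matrix (Fin M) (Fin M) ℂ :=
  Matrix.of fun m n => partialDeriv k (partialDeriv l fun θ' => covModel u θ' m n) θ

/-- The search domain: `ω₀` ranges over `K`, all the other parameters over `ℝ`. -/
def searchDomain (D : ℕ) (K : Set ℝ) : Set (Param D → ℝ) := {θ | θ .omega ∈ K}

/-- `X` is a zero-mean circular complex Gaussian random vector with covariance matrix `R`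
(possibly singular): it is Gaussian as a real random vector, with `E[X] = 0`, `E[X Xᵀ] = 0`
and `E[X Xᴴ] = R`. -/
structure IsCircularGaussian [MeasurableSpace Ω] (X : Ω → Fin M → ℂ)
    (R : Matrix (Fin M) (Fin M) ℂ) (μ : Measure Ω) : Prop where
  gaussian : HasGaussianLaw X μ
  mean_eq : ∀ k, ∫ o, X o k ∂μ = 0
  pseudoCov_eq : ∀ k l, ∫ o, X o k * X o l ∂μ = 0
  cov_eq : ∀ k l, ∫ o, X o k * star (X o l) ∂μ = R k l

end

end MoMET

open MoMET

/-!
The asymptotic covariance of a least-squares estimator is obtained here without any convergence in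
distribution, by a linearization with a *deterministic* remainder.

Put `Δ = R̄_N - R`. Since `θ₀` is an interior minimizer of `J_∞`, the gradient of `J_N` at `θ₀` is
linear in `Δ`: its `k`-th coordinate is `-⟨Δ, ∂R̂/∂θ_k⟩`, for the real bilinear form
`⟨X, Y⟩ = Re tr (W X W Yᴴ)` (`partialDeriv_cost_eq_neg_weightedForm`). On Hermitian matrices the
form is a trace, so this coordinate is minus an average of `N` independent centred quadratic forms
of the samples (`weightedForm_sampleCov_sub`). Wick's formula for circular Gaussian vectors, itself
a polarization of `E[Y⁴] = 3 E[Y²]²`, gives the fourth-moment identity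
(`IsCircularGaussian.integral_quadForm_mul_quadForm`), and with it the exact equality
`N E[∇J_N(θ₀) ∇J_N(θ₀)ᵀ] = C₀` for every `N ≥ 1` (`natCast_mul_integral_weightedForm_mul`).

For the estimator, `exists_norm_minimizer_sub_sub_le` shows that *every* minimizer of `J_N` over the
search domain is `θ₀ - H⁻¹ ∇J_N(θ₀) + O(‖Δ‖²)`, with one constant for all `Δ`. For small `Δ`, the
minimizer is close to `θ₀` by compactness and uniqueness, hence is an interior critical point, and a
second-order expansion of the gradient applies. For large `Δ`, the estimate follows from the growth
bound `‖θ‖ ≤ C (1 + ‖Δ‖)`: uniqueness of `θ₀` makes the parametrization injective in the parameters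
other than `ω₀`, uniformly in `ω₀` because the steering factors are unimodular
(`exists_norm_le_of_unique_minimizer`).

Since `E[‖Δ‖⁴] = O(N⁻²)` (`exists_integral_sum_norm_sampleCov_sub_pow_four_le`), all moments
involved are finite, and replacing the estimation error by its linearization changes its second
moments by `O(E[‖Δ‖³] + E[‖Δ‖⁴]) = O(N^(-3/2))` (`integral_mul_sub_integral_mul_le`).
-/

namespace MoMET

/-! ### Random variables with finite moments of all orders -/

section Moments

open scoped ENNReal

variable {Ω 𝕜 : Type*} [MeasurableSpace Ω] {μ : Measure Ω} [RCLike 𝕜]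

/-- A random variable has finite moments of all orders if it lies in `L^p` for every finite `p`. -/
def HasAllMoments (f : Ω → 𝕜) (μ : Measure Ω) : Prop := ∀ p : ℝ≥0∞, p ≠ ∞ → MemLp f p μ

namespace HasAllMoments

variable {f g : Ω → 𝕜}

lemma integrable (hf : HasAllMoments f μ) : Integrable f μ :=
  memLp_one_iff_integrable.1 (hf 1 (by norm_num))

lemma mul (hf : HasAllMoments f μ) (hg : HasAllMoments g μ) :
    HasAllMoments (fun o => f o * g o) μ := by
  intro p hp
  have h2 : (2 * p : ℝ≥0∞) ≠ ∞ := ENNReal.mul_ne_top (by norm_num) hp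
  have : ENNReal.HolderTriple (2 * p) (2 * p) p := ⟨by
    rw [ENNReal.mul_inv (by norm_num) (by norm_num), ← add_mul, ENNReal.inv_two_add_inv_two,
      one_mul]⟩
  exact (hg _ h2).mul (hf _ h2)

lemma add (hf : HasAllMoments f μ) (hg : HasAllMoments g μ) :
    HasAllMoments (fun o => f o + g o) μ := fun p hp => (hf p hp).add (hg p hp)

lemma sub (hf : HasAllMoments f μ) (hg : HasAllMoments g μ) :
    HasAllMoments (fun o => f o - g o) μ := fun p hp => (hf p hp).sub (hg p hp)

lemma const_mul (hf : HasAllMoments f μ) (c : 𝕜) :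
    HasAllMoments (fun o => c * f o) μ := fun p hp => (hf p hp).const_mul c

lemma const [IsFiniteMeasure μ] (c : 𝕜) : HasAllMoments (fun _ => c) μ :=
  fun _ _ => memLp_const c

lemma pow [IsFiniteMeasure μ] (hf : HasAllMoments f μ) (n : ℕ) :
    HasAllMoments (fun o => f o ^ n) μ := by
  induction n with
  | zero => simpa using const (1 : 𝕜)
  | succ n ih => simpa only [pow_succ] using ih.mul hf

lemma sum {ι : Type*} (s : Finset ι) {f : ι → Ω → 𝕜} (hf : ∀ i ∈ s, HasAllMoments (f i) μ) :
    HasAllMoments (fun o => ∑ i ∈ s, f i o) μ := fun p hp =>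
  memLp_finsetSum s fun i hi => hf i hi p hp

lemma star (hf : HasAllMoments f μ) : HasAllMoments (fun o => star (f o)) μ := fun p hp =>
  (memLp_congr_norm (hf p hp).1 (continuous_star.comp_aestronglyMeasurable (hf p hp).1)
    (by filter_upwards with o; simp)).1 (hf p hp)

lemma norm (hf : HasAllMoments f μ) : HasAllMoments (fun o => ‖f o‖) μ :=
  fun p hp => (hf p hp).norm

lemma ofReal {f : Ω → ℝ} (hf : HasAllMoments f μ) : HasAllMoments (fun o => (f o : ℂ)) μ :=
  fun p hp => (hf p hp).ofReal

lemma re {f : Ω → ℂ} (hf : HasAllMoments f μ) : HasAllMoments (fun o => (f o).re) μ :=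
  fun p hp => (hf p hp).re

lemma im {f : Ω → ℂ} (hf : HasAllMoments f μ) : HasAllMoments (fun o => (f o).im) μ :=
  fun p hp => (hf p hp).im

end HasAllMoments

end Moments

/-! ### Fourth moments of Gaussian vectors -/

section Wick

variable {Ω : Type*} [MeasurableSpace Ω] {μ : Measure Ω}

lemma integral_pow_four_gaussianReal (v : NNReal) :
    ∫ y, y ^ 4 ∂(gaussianReal 0 v) = 3 * (v : ℝ) ^ 2 := by
  have h : ∫ y, y ^ 4 ∂(gaussianReal 0 v) =
      iteratedDeriv 4 (mgf (fun x ↦ x) (gaussianReal 0 v)) 0 := by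
    rw [iteratedDeriv_mgf_zero] <;> simp
  rw [h, mgf_fun_id_gaussianReal]
  -- Derivatives of `P(t) exp(v t² / 2)` with `P` polynomial have the same form.
  have hd : ∀ P P' : ℝ → ℝ, (∀ t, HasDerivAt P (P' t) t) →
      deriv (fun t : ℝ => P t * Real.exp (0 * t + v * t ^ 2 / 2)) =
        fun t => (P' t + v * t * P t) * Real.exp (0 * t + v * t ^ 2 / 2) := by
    intro P P' hP
    ext t
    have h1 : HasDerivAt (fun t : ℝ => 0 * t + v * t ^ 2 / 2) (v * t) t := by
      have := ((hasDerivAt_id t).const_mul (0 : ℝ)).add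
        ((((hasDerivAt_id t).pow 2).const_mul (v : ℝ)).div_const 2)
      refine this.congr_deriv ?_
      simp; ring
    refine (((hP t).mul h1.exp).congr_deriv ?_).deriv
    ring
  have e0 : (fun t : ℝ => Real.exp (0 * t + v * t ^ 2 / 2)) =
      fun t => (1 : ℝ) * Real.exp (0 * t + v * t ^ 2 / 2) := by simp
  have p1 : ∀ t : ℝ, HasDerivAt (fun t : ℝ => v * t) (v : ℝ) t := fun t => by
    simpa using (hasDerivAt_id t).const_mul (v : ℝ)
  have p2 : ∀ t : ℝ, HasDerivAt (fun t : ℝ => v + v * t * (v * t)) (2 * v ^ 2 * t) t := fun t => by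
    refine (((p1 t).mul (p1 t)).const_add (v : ℝ)).congr_deriv ?_
    ring
  have p3 : ∀ t : ℝ, HasDerivAt (fun t : ℝ => 2 * v ^ 2 * t + v * t * (v + v * t * (v * t)))
      (3 * v ^ 2 + 3 * v ^ 3 * t ^ 2) t := fun t => by
    refine (((hasDerivAt_id t).const_mul (2 * (v : ℝ) ^ 2)).add ((p1 t).mul (p2 t))).congr_deriv ?_
    ring
  rw [iteratedDeriv_succ, iteratedDeriv_succ, iteratedDeriv_succ, iteratedDeriv_one, e0,
    hd _ (fun _ => 0) (fun t => hasDerivAt_const t _)]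
  simp only [zero_add, mul_one]
  rw [hd _ _ p1, hd _ _ p2, hd _ _ p3]
  simp

lemma integral_pow_four_of_hasGaussianLaw {X : Ω → ℝ} (hX : HasGaussianLaw X μ)
    (h0 : ∫ o, X o ∂μ = 0) : ∫ o, X o ^ 4 ∂μ = 3 * (∫ o, X o ^ 2 ∂μ) ^ 2 := by
  have hlaw := hX.map_eq_gaussianReal
  have hv : Var[X; μ] = ∫ o, X o ^ 2 ∂μ := by
    rw [variance_eq_integral hX.aemeasurable]; simp [h0]
  rw [h0] at hlaw
  have h1 : ∫ o, X o ^ 4 ∂μ = ∫ y, y ^ 4 ∂(μ.map X) := by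
    rw [integral_map hX.aemeasurable (by fun_prop)]
  rw [h1, hlaw, integral_pow_four_gaussianReal, Real.coe_toNNReal _ (variance_nonneg _ _), hv]

variable {V : Type*} [NormedAddCommGroup V] [NormedSpace ℝ V] [MeasurableSpace V] [BorelSpace V]
  {X : Ω → V}

lemma HasAllMoments.of_hasGaussianLaw {X : Ω → ℝ} (hX : HasGaussianLaw X μ) :
    HasAllMoments X μ := fun _ hp => hX.memLp hp

/-- Wick's formula for four real functionals of a centred Gaussian vector. It follows by
polarization from the fourth moment of a real Gaussian variable. -/
lemma wick_four_real (hX : HasGaussianLaw X μ) (h0 : ∀ L : V →L[ℝ] ℝ, ∫ o, L (X o) ∂μ = 0)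
    (a b c d : V →L[ℝ] ℝ) :
    ∫ o, a (X o) * b (X o) * c (X o) * d (X o) ∂μ =
      (∫ o, a (X o) * b (X o) ∂μ) * (∫ o, c (X o) * d (X o) ∂μ) +
      (∫ o, a (X o) * c (X o) ∂μ) * (∫ o, b (X o) * d (X o) ∂μ) +
      (∫ o, a (X o) * d (X o) ∂μ) * (∫ o, b (X o) * c (X o) ∂μ) := by
  have := hX.isProbabilityMeasure
  have hm : ∀ L : V →L[ℝ] ℝ, HasAllMoments (fun o => L (X o)) μ := fun L =>
    .of_hasGaussianLaw (hX.map_fun L)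
  have hi2 : ∀ L L' : V →L[ℝ] ℝ, Integrable (fun o => L (X o) * L' (X o)) μ := fun L L' =>
    ((hm L).mul (hm L')).integrable
  have key : ∀ s t r : ℝ, ∫ o, (a (X o) + s * b (X o) + t * c (X o) + r * d (X o)) ^ 4 ∂μ =
      3 * (∫ o, a (X o) * a (X o) ∂μ + s ^ 2 * ∫ o, b (X o) * b (X o) ∂μ +
        t ^ 2 * ∫ o, c (X o) * c (X o) ∂μ + r ^ 2 * ∫ o, d (X o) * d (X o) ∂μ +
        2 * s * ∫ o, a (X o) * b (X o) ∂μ + 2 * t * ∫ o, a (X o) * c (X o) ∂μ +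
        2 * r * ∫ o, a (X o) * d (X o) ∂μ + 2 * s * t * ∫ o, b (X o) * c (X o) ∂μ +
        2 * s * r * ∫ o, b (X o) * d (X o) ∂μ + 2 * t * r * ∫ o, c (X o) * d (X o) ∂μ) ^ 2 := by
    intro s t r
    have hL := integral_pow_four_of_hasGaussianLaw (hX.map_fun (a + s • b + t • c + r • d))
      (h0 _)
    simp only [_root_.add_apply, _root_.smul_apply, smul_eq_mul] at hL
    rw [hL]
    congr 2
    simp only [← integral_const_mul]
    have i2 : ∀ (k : ℝ) (L L' : V →L[ℝ] ℝ), Integrable (fun o => k * (L (X o) * L' (X o))) μ :=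
      fun k L L' => (hi2 L L').const_mul k
    rw [← integral_add (by fun_prop) (by fun_prop), ← integral_add (by fun_prop) (by fun_prop),
      ← integral_add (by fun_prop) (by fun_prop), ← integral_add (by fun_prop) (by fun_prop),
      ← integral_add (by fun_prop) (by fun_prop), ← integral_add (by fun_prop) (by fun_prop),
      ← integral_add (by fun_prop) (by fun_prop), ← integral_add (by fun_prop) (by fun_prop),
      ← integral_add (by fun_prop) (by fun_prop)]
    congr 1; ext o; ring
  have hq : ∀ s t r : ℝ,
      Integrable (fun o => (a (X o) + s * b (X o) + t * c (X o) + r * d (X o)) ^ 4) μ :=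
    fun s t r => (((((hm a).add ((hm b).const_mul s)).add ((hm c).const_mul t)).add
      ((hm d).const_mul r)).pow 4).integrable
  have h192 : 192 * ∫ o, a (X o) * b (X o) * c (X o) * d (X o) ∂μ =
      ∫ o, (a (X o) + 1 * b (X o) + 1 * c (X o) + 1 * d (X o)) ^ 4 ∂μ -
      ∫ o, (a (X o) + 1 * b (X o) + 1 * c (X o) + (-1) * d (X o)) ^ 4 ∂μ -
      ∫ o, (a (X o) + 1 * b (X o) + (-1) * c (X o) + 1 * d (X o)) ^ 4 ∂μ +
      ∫ o, (a (X o) + 1 * b (X o) + (-1) * c (X o) + (-1) * d (X o)) ^ 4 ∂μ -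
      ∫ o, (a (X o) + (-1) * b (X o) + 1 * c (X o) + 1 * d (X o)) ^ 4 ∂μ +
      ∫ o, (a (X o) + (-1) * b (X o) + 1 * c (X o) + (-1) * d (X o)) ^ 4 ∂μ +
      ∫ o, (a (X o) + (-1) * b (X o) + (-1) * c (X o) + 1 * d (X o)) ^ 4 ∂μ -
      ∫ o, (a (X o) + (-1) * b (X o) + (-1) * c (X o) + (-1) * d (X o)) ^ 4 ∂μ := by
    rw [← integral_const_mul, ← integral_sub (by fun_prop) (by fun_prop),
      ← integral_sub (by fun_prop) (by fun_prop), ← integral_add (by fun_prop) (by fun_prop),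
      ← integral_sub (by fun_prop) (by fun_prop), ← integral_add (by fun_prop) (by fun_prop),
      ← integral_add (by fun_prop) (by fun_prop), ← integral_sub (by fun_prop) (by fun_prop)]
    congr 1; ext o; ring
  simp only [key] at h192
  linarith

/-- Wick's formula for four complex functionals of a centred Gaussian vector; the functionals
are only real-linear, so that complex conjugates of coordinates are allowed. -/
lemma wick_four_complex (hX : HasGaussianLaw X μ) (h0 : ∀ L : V →L[ℝ] ℝ, ∫ o, L (X o) ∂μ = 0)
    (a b c d : V →L[ℝ] ℂ) :
    ∫ o, a (X o) * b (X o) * c (X o) * d (X o) ∂μ =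
      (∫ o, a (X o) * b (X o) ∂μ) * (∫ o, c (X o) * d (X o) ∂μ) +
      (∫ o, a (X o) * c (X o) ∂μ) * (∫ o, b (X o) * d (X o) ∂μ) +
      (∫ o, a (X o) * d (X o) ∂μ) * (∫ o, b (X o) * c (X o) ∂μ) := by
  have := hX.isProbabilityMeasure
  -- `W4 f g h k` is Wick's formula; it is linear in the first slot and invariant under rotation.
  set W4 : (Ω → ℂ) → (Ω → ℂ) → (Ω → ℂ) → (Ω → ℂ) → Prop := fun f g h k =>
    ∫ o, f o * g o * h o * k o ∂μ = (∫ o, f o * g o ∂μ) * (∫ o, h o * k o ∂μ) +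
      (∫ o, f o * h o ∂μ) * (∫ o, g o * k o ∂μ) +
      (∫ o, f o * k o ∂μ) * (∫ o, g o * h o ∂μ) with hW4
  have rot : ∀ f g h k, W4 f g h k → W4 g h k f := by
    intro f g h k H
    simp only [hW4] at H ⊢
    have e1 : ∀ o, g o * h o * k o * f o = f o * g o * h o * k o := fun o => by ring
    have e2 : ∀ o, k o * f o = f o * k o := fun o => mul_comm _ _
    have e3 : ∀ o, g o * f o = f o * g o := fun o => mul_comm _ _
    have e4 : ∀ o, h o * f o = f o * h o := fun o => mul_comm _ _
    simp only [e1, e2, e3, e4, H]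
    ring
  have lin : ∀ f f' g h k, HasAllMoments f μ → HasAllMoments f' μ → HasAllMoments g μ →
      HasAllMoments h μ → HasAllMoments k μ → W4 f g h k → W4 f' g h k →
      W4 (fun o => f o + Complex.I * f' o) g h k := by
    intro f f' g h k hf hf' hg hh hk H H'
    simp only [hW4] at H H' ⊢
    have two : ∀ g, HasAllMoments g μ → ∫ o, (f o + Complex.I * f' o) * g o ∂μ =
        ∫ o, f o * g o ∂μ + Complex.I * ∫ o, f' o * g o ∂μ := by
      intro g hg
      rw [← integral_const_mul, ← integral_add (hf.mul hg).integrable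
        ((hf'.mul hg).integrable.const_mul _)]
      congr 1; ext o; ring
    have e : ∀ f : Ω → ℂ, ∀ o, f o * g o * h o * k o = f o * (g o * h o * k o) :=
      fun f o => by ring
    rw [show (fun o => (f o + Complex.I * f' o) * g o * h o * k o) =
      fun o => (f o + Complex.I * f' o) * (g o * h o * k o) from by ext o; ring,
      two _ ((hg.mul hh).mul hk), two _ hg, two _ hh, two _ hk]
    simp only [e] at H H'
    rw [H, H']
    ring
  have hr : ∀ L : V →L[ℝ] ℝ, HasAllMoments (fun o => ((L (X o) : ℝ) : ℂ)) μ := fun L =>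
    (HasAllMoments.of_hasGaussianLaw (hX.map_fun L)).ofReal
  set re : (V →L[ℝ] ℂ) → (V →L[ℝ] ℝ) := fun L => Complex.reCLM.comp L
  set im : (V →L[ℝ] ℂ) → (V →L[ℝ] ℝ) := fun L => Complex.imCLM.comp L
  have dec : ∀ L : V →L[ℝ] ℂ, (fun o => L (X o)) =
      fun o => ((re L (X o) : ℝ) : ℂ) + Complex.I * ((im L (X o) : ℝ) : ℂ) := by
    intro L; ext o
    rw [mul_comm]
    exact (Complex.re_add_im _).symm
  have hc : ∀ L : V →L[ℝ] ℂ, HasAllMoments (fun o => L (X o)) μ := fun L => by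
    rw [dec L]; exact (hr _).add ((hr _).const_mul _)
  have w0 : ∀ a b c d : V →L[ℝ] ℝ, W4 (fun o => ((a (X o) : ℝ) : ℂ))
      (fun o => ((b (X o) : ℝ) : ℂ)) (fun o => ((c (X o) : ℝ) : ℂ))
      (fun o => ((d (X o) : ℝ) : ℂ)) := by
    intro a b c d
    simp only [hW4, ← Complex.ofReal_mul, integral_complex_ofReal, wick_four_real hX h0 a b c d]
    push_cast
    ring
  have step : ∀ (L : V →L[ℝ] ℂ) g h k, HasAllMoments g μ → HasAllMoments h μ →
      HasAllMoments k μ → (∀ L' : V →L[ℝ] ℝ, W4 (fun o => ((L' (X o) : ℝ) : ℂ)) g h k) →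
      W4 (fun o => L (X o)) g h k := by
    intro L g h k hg hh hk H
    rw [dec L]
    exact lin _ _ _ _ _ (hr _) (hr _) hg hh hk (H _) (H _)
  have w1 : ∀ (a : V →L[ℝ] ℂ) (b c d : V →L[ℝ] ℝ), W4 (fun o => ((b (X o) : ℝ) : ℂ))
      (fun o => ((c (X o) : ℝ) : ℂ)) (fun o => ((d (X o) : ℝ) : ℂ)) (fun o => a (X o)) :=
    fun a b c d => rot _ _ _ _ (step a _ _ _ (hr _) (hr _) (hr _) fun L' => w0 _ _ _ _)
  have w2 : ∀ (a b : V →L[ℝ] ℂ) (c d : V →L[ℝ] ℝ), W4 (fun o => ((c (X o) : ℝ) : ℂ))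
      (fun o => ((d (X o) : ℝ) : ℂ)) (fun o => a (X o)) (fun o => b (X o)) :=
    fun a b c d => rot _ _ _ _ (step b _ _ _ (hr _) (hr _) (hc _) fun L' => w1 _ _ _ _)
  have w3 : ∀ (a b c : V →L[ℝ] ℂ) (d : V →L[ℝ] ℝ), W4 (fun o => ((d (X o) : ℝ) : ℂ))
      (fun o => a (X o)) (fun o => b (X o)) (fun o => c (X o)) :=
    fun a b c d => rot _ _ _ _ (step c _ _ _ (hr _) (hc _) (hc _) fun L' => w2 _ _ _ _)
  exact rot _ _ _ _ (step d _ _ _ (hc _) (hc _) (hc _) fun L' => w3 a b c L')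

end Wick

/-! ### Circular Gaussian vectors -/

lemma dotProduct_mulVec_eq_sum {M : ℕ} (A : Matrix (Fin M) (Fin M) ℂ) (z : Fin M → ℂ) :
    star z ⬝ᵥ A *ᵥ z = ∑ i, ∑ j, A i j * (star (z i) * z j) := by
  simp only [dotProduct, Matrix.mulVec, Finset.mul_sum, Pi.star_apply]
  refine Finset.sum_congr rfl fun i _ => Finset.sum_congr rfl fun j _ => ?_
  ring

namespace IsCircularGaussian

variable {M : ℕ} {Ω : Type*} [MeasurableSpace Ω] {μ : Measure Ω} {X : Ω → Fin M → ℂ}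
  {R : Matrix (Fin M) (Fin M) ℂ}

lemma hasAllMoments (hX : IsCircularGaussian X R μ) (k : Fin M) :
    HasAllMoments (fun o => X o k) μ := fun _ hp =>
  (hX.gaussian.map_fun (ContinuousLinearMap.proj (R := ℝ) (φ := fun _ : Fin M => ℂ) k)).memLp hp

lemma isHermitian (hX : IsCircularGaussian X R μ) : R.IsHermitian := by
  ext k l
  rw [Matrix.conjTranspose_apply, ← hX.cov_eq, ← hX.cov_eq, Complex.star_def, ← integral_conj]
  congr 1; ext o
  simp [mul_comm]

/-- A real-linear functional of a zero-mean vector has zero mean. -/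
lemma integral_dual_eq_zero (hX : IsCircularGaussian X R μ) (L : (Fin M → ℂ) →L[ℝ] ℝ) :
    ∫ o, L (X o) ∂μ = 0 := by
  have hi : Integrable X μ := hX.gaussian.integrable
  rw [L.integral_comp_comm hi]
  have : ∫ o, X o ∂μ = 0 := by
    ext k
    have := (ContinuousLinearMap.proj (R := ℝ) (φ := fun _ : Fin M => ℂ) k).integral_comp_comm hi
    simp only [ContinuousLinearMap.proj_apply] at this
    rw [← this, hX.mean_eq]; rfl
  rw [this, map_zero]

lemma integral_star_mul (hX : IsCircularGaussian X R μ) (k l : Fin M) :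
    ∫ o, star (X o k) * X o l ∂μ = R l k := by
  rw [← hX.cov_eq]; congr 1; ext o; ring

/-- Wick's formula for the coordinates of a circular Gaussian vector: the pairing of the two
conjugated coordinates does not contribute. -/
lemma integral_four (hX : IsCircularGaussian X R μ) (i j k l : Fin M) :
    ∫ o, star (X o i) * X o j * star (X o k) * X o l ∂μ = R j i * R l k + R l i * R j k := by
  set p : Fin M → ((Fin M → ℂ) →L[ℝ] ℂ) :=
    fun k => ContinuousLinearMap.proj (R := ℝ) (φ := fun _ : Fin M => ℂ) k
  have h := wick_four_complex hX.gaussian hX.integral_dual_eq_zero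
    ((Complex.conjCLE : ℂ →L[ℝ] ℂ).comp (p i)) (p j)
    ((Complex.conjCLE : ℂ →L[ℝ] ℂ).comp (p k)) (p l)
  simp only [ContinuousLinearMap.comp_apply, p, ContinuousLinearMap.proj_apply,
    ContinuousLinearEquiv.coe_coe, Complex.conjCLE_apply, ← Complex.star_def] at h
  rw [h, hX.integral_star_mul, hX.integral_star_mul, hX.integral_star_mul, hX.cov_eq,
    hX.pseudoCov_eq, mul_zero, add_zero]

lemma hasAllMoments_quadForm (hX : IsCircularGaussian X R μ) (A : Matrix (Fin M) (Fin M) ℂ) :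
    HasAllMoments (fun o => star (X o) ⬝ᵥ A *ᵥ X o) μ := by
  simp only [dotProduct_mulVec_eq_sum]
  exact .sum _ fun i _ => .sum _ fun j _ =>
    ((hX.hasAllMoments i).star.mul (hX.hasAllMoments j)).const_mul _

lemma integral_quadForm (hX : IsCircularGaussian X R μ) (A : Matrix (Fin M) (Fin M) ℂ) :
    ∫ o, star (X o) ⬝ᵥ A *ᵥ X o ∂μ = (R * A).trace := by
  have hi : ∀ i j, Integrable (fun o => A i j * (star (X o i) * X o j)) μ := fun i j =>
    (((hX.hasAllMoments i).star.mul (hX.hasAllMoments j)).const_mul _).integrable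
  simp only [dotProduct_mulVec_eq_sum]
  rw [integral_finsetSum _ fun i _ => integrable_finsetSum _ fun j _ => hi i j]
  simp_rw [integral_finsetSum _ fun j (_ : j ∈ Finset.univ) => hi _ j, integral_const_mul,
    hX.integral_star_mul]
  rw [Finset.sum_comm]
  simp only [Matrix.trace, Matrix.diag_apply, Matrix.mul_apply]
  exact Finset.sum_congr rfl fun i _ => Finset.sum_congr rfl fun j _ => mul_comm _ _

/-- The fourth-moment identity for two quadratic forms of a circular Gaussian vector. -/
lemma integral_quadForm_mul_quadForm (hX : IsCircularGaussian X R μ)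
    (A B : Matrix (Fin M) (Fin M) ℂ) :
    ∫ o, (star (X o) ⬝ᵥ A *ᵥ X o) * (star (X o) ⬝ᵥ B *ᵥ X o) ∂μ =
      (R * A).trace * (R * B).trace + (R * A * R * B).trace := by
  have hi : ∀ i j k l, Integrable (fun o =>
      A i j * B k l * (star (X o i) * X o j * star (X o k) * X o l)) μ := fun i j k l =>
    (((((hX.hasAllMoments i).star.mul (hX.hasAllMoments j)).mul (hX.hasAllMoments k).star).mul
      (hX.hasAllMoments l)).const_mul _).integrable
  have e : ∀ o, (star (X o) ⬝ᵥ A *ᵥ X o) * (star (X o) ⬝ᵥ B *ᵥ X o) =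
      ∑ i, ∑ j, ∑ k, ∑ l, A i j * B k l * (star (X o i) * X o j * star (X o k) * X o l) := by
    intro o
    simp only [dotProduct_mulVec_eq_sum, Finset.sum_mul]
    refine Finset.sum_congr rfl fun i _ => Finset.sum_congr rfl fun j _ => ?_
    simp only [Finset.mul_sum]
    refine Finset.sum_congr rfl fun k _ => Finset.sum_congr rfl fun l _ => ?_
    ring
  simp only [e]
  rw [integral_finsetSum _ fun i _ => integrable_finsetSum _ fun j _ =>
    integrable_finsetSum _ fun k _ => integrable_finsetSum _ fun l _ => hi i j k l]
  simp_rw [integral_finsetSum _ fun j (_ : j ∈ Finset.univ) =>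
    integrable_finsetSum _ fun k _ => integrable_finsetSum _ fun l _ => hi _ j k l,
    integral_finsetSum _ fun k (_ : k ∈ Finset.univ) =>
      integrable_finsetSum _ fun l _ => hi _ _ k l,
    integral_finsetSum _ fun l (_ : l ∈ Finset.univ) => hi _ _ _ l, integral_const_mul,
    hX.integral_four, mul_add, Finset.sum_add_distrib]
  congr 1
  · simp only [Matrix.trace, Matrix.diag_apply, Matrix.mul_apply]
    rw [Finset.sum_comm (f := fun x i => R x i * A i x),
      Finset.sum_comm (f := fun x i => R x i * B i x), Finset.sum_mul]
    refine Finset.sum_congr rfl fun i _ => ?_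
    rw [Finset.sum_mul]
    refine Finset.sum_congr rfl fun j _ => ?_
    rw [Finset.mul_sum]
    refine Finset.sum_congr rfl fun k _ => ?_
    rw [Finset.mul_sum]
    refine Finset.sum_congr rfl fun l _ => ?_
    ring
  · have : (R * A * R * B).trace = (A * (R * (B * R))).trace := by
      rw [Matrix.mul_assoc, Matrix.mul_assoc, Matrix.trace_mul_comm]
      simp only [Matrix.mul_assoc]
    rw [this]
    simp only [Matrix.trace, Matrix.diag_apply, Matrix.mul_apply, Finset.mul_sum]
    refine Finset.sum_congr rfl fun i _ => Finset.sum_congr rfl fun j _ =>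
      Finset.sum_congr rfl fun k _ => Finset.sum_congr rfl fun l _ => ?_
    ring

lemma integral_re_sq (hX : IsCircularGaussian X R μ) (k : Fin M) :
    ∫ o, (X o k).re ^ 2 ∂μ = (R k k).re / 2 := by
  have h1 := congrArg Complex.re (hX.cov_eq k k)
  have h2 := congrArg Complex.re (hX.pseudoCov_eq k k)
  have hm := hX.hasAllMoments k
  rw [← RCLike.re_eq_complex_re, ← integral_re (hm.mul hm.star).integrable] at h1
  rw [← RCLike.re_eq_complex_re, ← integral_re (hm.mul hm).integrable] at h2
  simp only [RCLike.re_eq_complex_re, Complex.mul_re, Complex.star_def, Complex.conj_re,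
    Complex.conj_im, Complex.zero_re] at h1 h2
  have := integral_add (hm.mul hm.star).re.integrable (hm.mul hm).re.integrable
  simp only [Complex.mul_re, Complex.star_def, Complex.conj_re, Complex.conj_im] at this
  rw [h1, h2] at this
  rw [← add_zero (R k k).re, ← this, ← integral_div]
  congr 1; ext o; ring

lemma integral_im_sq (hX : IsCircularGaussian X R μ) (k : Fin M) :
    ∫ o, (X o k).im ^ 2 ∂μ = (R k k).re / 2 := by
  have := hX.gaussian.isProbabilityMeasure
  have h1 := congrArg Complex.re (hX.cov_eq k k)
  have hm := hX.hasAllMoments k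
  rw [← RCLike.re_eq_complex_re, ← integral_re (hm.mul hm.star).integrable] at h1
  simp only [RCLike.re_eq_complex_re, Complex.mul_re, Complex.star_def, Complex.conj_re,
    Complex.conj_im] at h1
  have h3 := integral_add (hm.re.pow 2).integrable (hm.im.pow 2).integrable
  rw [hX.integral_re_sq k] at h3
  have : ∫ o, ((X o k).re ^ 2 + (X o k).im ^ 2) ∂μ = (R k k).re := by
    rw [← h1]; congr 1; ext o; ring
  linarith

end IsCircularGaussian

/-- A centred real Gaussian variable with second moment `v` has law `gaussianReal 0 v`. -/
lemma map_eq_gaussianReal_of_integral {Ω : Type*} [MeasurableSpace Ω] {μ : Measure Ω} {Y : Ω → ℝ}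
    (hY : HasGaussianLaw Y μ) (h0 : ∫ o, Y o ∂μ = 0) {v : ℝ} (hv : ∫ o, Y o ^ 2 ∂μ = v) :
    μ.map Y = gaussianReal 0 v.toNNReal := by
  have hlaw := hY.map_eq_gaussianReal
  have h : Var[Y; μ] = v := by
    rw [variance_eq_integral hY.aemeasurable, ← hv]; simp [h0]
  rwa [h0, h] at hlaw

/-- The even moments of the coordinates of a circular Gaussian vector are those of a real
Gaussian variable that depends on the covariance matrix only. -/
lemma IsCircularGaussian.integral_re_im_pow {M : ℕ} {Ω : Type*} [MeasurableSpace Ω]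
    {μ : Measure Ω} {X : Ω → Fin M → ℂ} {R : Matrix (Fin M) (Fin M) ℂ}
    (hX : IsCircularGaussian X R μ) (k : Fin M) (n : ℕ) :
    ∫ o, (X o k).re ^ n ∂μ = ∫ y, y ^ n ∂(gaussianReal 0 ((R k k).re / 2).toNNReal) ∧
    ∫ o, (X o k).im ^ n ∂μ = ∫ y, y ^ n ∂(gaussianReal 0 ((R k k).re / 2).toNNReal) := by
  have hk := hX.gaussian.map_fun
    (ContinuousLinearMap.proj (R := ℝ) (φ := fun _ : Fin M => ℂ) k)
  have hre : HasGaussianLaw (fun o => (X o k).re) μ := hk.map_fun Complex.reCLM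
  have him : HasGaussianLaw (fun o => (X o k).im) μ := hk.map_fun Complex.imCLM
  have h0 := hX.integral_dual_eq_zero
    (Complex.reCLM.comp (ContinuousLinearMap.proj (R := ℝ) (φ := fun _ : Fin M => ℂ) k))
  have h0' := hX.integral_dual_eq_zero
    (Complex.imCLM.comp (ContinuousLinearMap.proj (R := ℝ) (φ := fun _ : Fin M => ℂ) k))
  have e1 := map_eq_gaussianReal_of_integral hre h0 (hX.integral_re_sq k)
  have e2 := map_eq_gaussianReal_of_integral him h0' (hX.integral_im_sq k)
  constructor
  · rw [← e1, integral_map hre.aemeasurable (by fun_prop)]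
  · rw [← e2, integral_map him.aemeasurable (by fun_prop)]

/-! ### Fourth moments of sums of independent variables -/

section Sums

variable {Ω : Type*} [MeasurableSpace Ω] {μ : Measure Ω} [IsProbabilityMeasure μ]

lemma integral_pow_mul_pow_of_indepFun {S Y : Ω → ℝ} (h : IndepFun S Y μ)
    (hS : HasAllMoments S μ) (hY : HasAllMoments Y μ) (i j : ℕ) :
    ∫ o, S o ^ i * Y o ^ j ∂μ = (∫ o, S o ^ i ∂μ) * ∫ o, Y o ^ j ∂μ :=
  (h.comp (measurable_id.pow_const i) (measurable_id.pow_const j)).integral_fun_mul_eq_mul_integral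
    (hS.pow i).integrable.1 (hY.pow j).integrable.1

lemma integral_sq_sq_le {Y : Ω → ℝ} (hY : HasAllMoments Y μ) :
    (∫ o, Y o ^ 2 ∂μ) ^ 2 ≤ ∫ o, Y o ^ 4 ∂μ := by
  have h := variance_nonneg (fun o => Y o ^ 2) μ
  rw [variance_eq_sub ((hY.pow 2) 2 (by norm_num))] at h
  have e : ∫ o, Y o ^ 4 ∂μ = μ[(fun o => Y o ^ 2) ^ 2] := by
    congr 1; ext o; simp only [Pi.pow_apply]; ring
  rw [e]; linarith

/-- The fourth moment of a sum of `N` independent centred variables is `O(N ^ 2)`: expanding the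
fourth power, only the squares contribute to the leading order. -/
lemma integral_sum_pow_four_le {ξ : ℕ → Ω → ℝ} (hm : ∀ t, HasAllMoments (ξ t) μ)
    (hind : iIndepFun ξ μ) (h0 : ∀ t, ∫ o, ξ t o ∂μ = 0) {K : ℝ}
    (hK : ∀ t, ∫ o, ξ t o ^ 4 ∂μ ≤ K) (N : ℕ) :
    ∫ o, (∑ t ∈ Finset.range N, ξ t o) ^ 4 ∂μ ≤ 3 * K * N ^ 2 := by
  have hK0 : 0 ≤ K := (integral_nonneg fun o => by positivity).trans (hK 0)
  have hsq : ∀ t, ∫ o, ξ t o ^ 2 ∂μ ≤ √K := fun t =>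
    Real.le_sqrt_of_sq_le ((integral_sq_sq_le (hm t)).trans (hK t))
  have hSm : ∀ n, HasAllMoments (fun o => ∑ t ∈ Finset.range n, ξ t o) μ := fun n =>
    .sum _ fun t _ => hm t
  have hSi : ∀ n, IndepFun (fun o => ∑ t ∈ Finset.range n, ξ t o) (ξ n) μ := fun n => by
    have := hind.indepFun_sum_range_succ₀ (fun t => (hm t).integrable.1.aemeasurable) n
    convert this using 1
    ext o; simp
  have hmul : ∀ n i j, ∫ o, (∑ t ∈ Finset.range n, ξ t o) ^ i * ξ n o ^ j ∂μ =
      (∫ o, (∑ t ∈ Finset.range n, ξ t o) ^ i ∂μ) * ∫ o, ξ n o ^ j ∂μ := fun n i j =>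
    integral_pow_mul_pow_of_indepFun (hSi n) (hSm n) (hm n) i j
  have hint : ∀ n i j, Integrable (fun o => (∑ t ∈ Finset.range n, ξ t o) ^ i * ξ n o ^ j) μ :=
    fun n i j => (((hSm n).pow i).mul ((hm n).pow j)).integrable
  have h2 : ∀ n, ∫ o, (∑ t ∈ Finset.range n, ξ t o) ^ 2 ∂μ ≤ n * √K := by
    intro n
    induction n with
    | zero => simp
    | succ n ih =>
      have e : ∀ o, (∑ t ∈ Finset.range (n + 1), ξ t o) ^ 2 =
          (∑ t ∈ Finset.range n, ξ t o) ^ 2 * ξ n o ^ 0 +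
          2 * ((∑ t ∈ Finset.range n, ξ t o) ^ 1 * ξ n o ^ 1) +
          (∑ t ∈ Finset.range n, ξ t o) ^ 0 * ξ n o ^ 2 := fun o => by
        rw [Finset.sum_range_succ]; ring
      simp only [e]
      rw [integral_add (by fun_prop) (by fun_prop), integral_add (by fun_prop) (by fun_prop),
        integral_const_mul, hmul, hmul, hmul]
      simp only [pow_one, h0, pow_zero, integral_const, probReal_univ, one_smul]
      push_cast
      linarith [hsq n]
  induction N with
  | zero => simp
  | succ n ih =>
    have e : ∀ o, (∑ t ∈ Finset.range (n + 1), ξ t o) ^ 4 =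
        (∑ t ∈ Finset.range n, ξ t o) ^ 4 * ξ n o ^ 0 +
        4 * ((∑ t ∈ Finset.range n, ξ t o) ^ 3 * ξ n o ^ 1) +
        6 * ((∑ t ∈ Finset.range n, ξ t o) ^ 2 * ξ n o ^ 2) +
        4 * ((∑ t ∈ Finset.range n, ξ t o) ^ 1 * ξ n o ^ 3) +
        (∑ t ∈ Finset.range n, ξ t o) ^ 0 * ξ n o ^ 4 := fun o => by
      rw [Finset.sum_range_succ]; ring
    simp only [e]
    have h0' : ∫ o, (∑ t ∈ Finset.range n, ξ t o) ∂μ = 0 := by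
      rw [integral_finsetSum _ fun t _ => (hm t).integrable]; simp [h0]
    rw [integral_add (by fun_prop) (by fun_prop), integral_add (by fun_prop) (by fun_prop),
      integral_add (by fun_prop) (by fun_prop), integral_add (by fun_prop) (by fun_prop),
      integral_const_mul, integral_const_mul, integral_const_mul, hmul, hmul, hmul, hmul, hmul]
    simp only [pow_one, h0, h0', pow_zero, integral_const, probReal_univ, one_smul]
    have hcross : (∫ o, (∑ t ∈ Finset.range n, ξ t o) ^ 2 ∂μ) * ∫ o, ξ n o ^ 2 ∂μ ≤ n * K := by
      calc _ ≤ (n * √K) * √K :=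
            mul_le_mul (h2 n) (hsq n) (integral_nonneg fun o => by positivity) (by positivity)
        _ = n * K := by rw [mul_assoc, Real.mul_self_sqrt hK0]
    push_cast
    nlinarith [hK n]

omit [IsProbabilityMeasure μ] in
/-- Mixed second moments add up along an independent sequence, as the cross terms vanish. -/
lemma integral_sum_mul_sum {E : Type*} [MeasurableSpace E] {x : ℕ → Ω → E} (hind : iIndepFun x μ)
    {p q : E → ℝ} (hp : Measurable p) (hq : Measurable q)
    (hpm : ∀ t, HasAllMoments (fun o => p (x t o)) μ)
    (hqm : ∀ t, HasAllMoments (fun o => q (x t o)) μ)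
    (hp0 : ∀ t, ∫ o, p (x t o) ∂μ = 0) {c : ℝ} (hc : ∀ t, ∫ o, p (x t o) * q (x t o) ∂μ = c)
    (N : ℕ) :
    ∫ o, (∑ t ∈ Finset.range N, p (x t o)) * (∑ t ∈ Finset.range N, q (x t o)) ∂μ = N * c := by
  have hi : ∀ s t, Integrable (fun o => p (x s o) * q (x t o)) μ := fun s t =>
    ((hpm s).mul (hqm t)).integrable
  simp only [Finset.sum_mul_sum]
  rw [integral_finsetSum _ fun s _ => integrable_finsetSum _ fun t _ => hi s t]
  simp_rw [integral_finsetSum _ fun t (_ : t ∈ Finset.range N) => hi _ t]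
  have : ∀ s t, ∫ o, p (x s o) * q (x t o) ∂μ = if s = t then c else 0 := by
    intro s t
    split_ifs with h
    · rw [← h, hc]
    · have := ((hind.indepFun h).comp hp hq).integral_fun_mul_eq_mul_integral
        (hpm s).integrable.1 (hqm t).integrable.1
      simp only [Function.comp_apply] at this
      rw [this, hp0, zero_mul]
  simp only [this, Finset.sum_ite_eq]
  rw [Finset.sum_congr rfl fun s hs => if_pos hs]
  simp

end Sums

/-! ### Perturbation of nonlinear least-squares minimizers -/

section Perturbation

variable {E F V : Type*} [NormedAddCommGroup E] [NormedSpace ℝ E] [NormedAddCommGroup F]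
  [NormedSpace ℝ F] [NormedAddCommGroup V] [NormedSpace ℝ V]

/-- The second-order Taylor bound for a twice differentiable map. -/
lemma exists_norm_sub_sub_fderiv_le {Φ : E → F} (hΦ : ContDiff ℝ 2 Φ) (p : E) :
    ∃ C r : ℝ, 0 ≤ C ∧ 0 < r ∧ ∀ q, ‖q - p‖ < r →
      ‖Φ q - Φ p - fderiv ℝ Φ p (q - p)‖ ≤ C * ‖q - p‖ ^ 2 := by
  have hd : DifferentiableAt ℝ (fderiv ℝ Φ) p :=
    (hΦ.fderiv_right (m := 1) (by norm_num)).differentiable (by norm_num) p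
  obtain ⟨C, hC0, hC⟩ := hd.isBigO_sub.exists_nonneg
  obtain ⟨r, hr, hball⟩ := Metric.eventually_nhds_iff.1 hC.bound
  refine ⟨C, r, hC0, hr, fun q hq => ?_⟩
  have hb : ∀ y ∈ Metric.closedBall p ‖q - p‖,
      ‖fderiv ℝ Φ y - fderiv ℝ Φ p‖ ≤ C * ‖q - p‖ := by
    intro y hy
    have hy' : ‖y - p‖ ≤ ‖q - p‖ := by rwa [← dist_eq_norm]
    refine (hball (y := y) ?_).trans (by gcongr)
    rw [dist_eq_norm]; exact hy'.trans_lt hq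
  have := (convex_closedBall p ‖q - p‖).norm_image_sub_le_of_norm_fderiv_le'
    (fun y _ => hΦ.differentiable (by norm_num) y) hb (Metric.mem_closedBall_self (norm_nonneg _))
    (show q ∈ Metric.closedBall p ‖q - p‖ by rw [Metric.mem_closedBall, dist_eq_norm])
  rw [pow_two, ← mul_assoc]; exact this

/-- The least-squares cost `½ B(C - S θ, C - S θ)` of fitting the model `S` to `C`, for a
bilinear form `B`. -/
noncomputable def lsCost (B : V →L[ℝ] V →L[ℝ] ℝ) (S : E → V) (C : V) (θ : E) : ℝ :=
  (1 / 2 : ℝ) * B (C - S θ) (C - S θ)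

/-- The derivative `e ↦ -B(C - S θ, S'(θ) e)` of `lsCost`. -/
noncomputable def lsGrad (B : V →L[ℝ] V →L[ℝ] ℝ) (S : E → V) (C : V) (θ : E) : E →L[ℝ] ℝ :=
  -((B (C - S θ)).comp (fderiv ℝ S θ))

variable {B : V →L[ℝ] V →L[ℝ] ℝ} {S : E → V}

lemma hasFDerivAt_lsCost (hB : ∀ X Y, B X Y = B Y X) (hS : Differentiable ℝ S) (C : V) (θ : E) :
    HasFDerivAt (lsCost B S C) (lsGrad B S C θ) θ := by
  have h1 : HasFDerivAt (fun θ => C - S θ) (-(fderiv ℝ S θ)) θ :=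
    (hS θ).hasFDerivAt.const_sub C
  have h2 := (B.isBoundedBilinearMap.hasFDerivAt (C - S θ, C - S θ)).comp θ (h1.prodMk h1)
  refine (h2.const_mul (1 / 2 : ℝ)).congr_fderiv ?_
  ext e
  simp [lsGrad, hB (fderiv ℝ S θ e)]
  ring

lemma contDiff_lsGrad {n : ℕ} (hS : ContDiff ℝ (n + 1 : ℕ) S) (C : V) :
    ContDiff ℝ n (lsGrad B S C) := by
  have h1 : ContDiff ℝ n (fderiv ℝ S) := hS.fderiv_right (by norm_cast)
  have h2 : ContDiff ℝ n fun θ => B (C - S θ) :=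
    B.contDiff.comp (contDiff_const.sub (hS.of_le (by norm_cast; omega)))
  exact (h2.clm_comp h1).neg

lemma hasFDerivAt_apply_const {G : Type*} [NormedAddCommGroup G] [NormedSpace ℝ G]
    {f : E → F →L[ℝ] G} {f' : E →L[ℝ] F →L[ℝ] G} {θ : E} (hf : HasFDerivAt f f' θ) (v : F) :
    HasFDerivAt (fun θ => f θ v) (f'.flip v) θ := by
  refine (hf.clm_apply (hasFDerivAt_const v θ)).congr_fderiv ?_
  ext e; simp

/-- The second derivative of `lsCost`. -/
lemma fderiv_lsGrad_apply (hB : ∀ X Y, B X Y = B Y X) (hS : ContDiff ℝ 2 S) (C : V) (θ e e' : E) :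
    fderiv ℝ (lsGrad B S C) θ e e' =
      B (fderiv ℝ (fderiv ℝ S) θ e e') (S θ - C) + B (fderiv ℝ S θ e) (fderiv ℝ S θ e') := by
  have h0 : HasFDerivAt (lsGrad B S C) _ θ :=
    ((contDiff_lsGrad (n := 1) (by exact_mod_cast hS) C).differentiable (by norm_num)
      θ).hasFDerivAt
  have hSd : Differentiable ℝ S := hS.differentiable (by norm_num)
  have hS2 : HasFDerivAt (fderiv ℝ S) _ θ :=
    ((hS.fderiv_right (m := 1) (by norm_num)).differentiable (by norm_num) θ).hasFDerivAt
  have h3 := ((B.isBoundedBilinearMap.hasFDerivAt (C - S θ, fderiv ℝ S θ e')).comp θ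
    (((hSd θ).hasFDerivAt.const_sub C).prodMk (hasFDerivAt_apply_const hS2 e'))).neg
  have h4 := (hasFDerivAt_apply_const h0 e').unique h3
  have h5 := congrArg (fun L : E →L[ℝ] ℝ => L e) h4
  simp only [ContinuousLinearMap.flip_apply] at h5
  rw [h5, hB (fderiv ℝ (fderiv ℝ S) θ e e'), ← neg_sub C]
  simp
  ring

omit [NormedAddCommGroup E] [NormedSpace ℝ E] in
lemma lsCost_add (hB : ∀ X Y, B X Y = B Y X) (C Δ : V) (θ : E) :
    lsCost B S (C + Δ) θ = lsCost B S C θ + B Δ (C - S θ) + (1 / 2 : ℝ) * B Δ Δ := by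
  simp only [lsCost, add_sub_right_comm, map_add, _root_.add_apply, hB (C - S θ) Δ]
  ring

omit [NormedSpace ℝ E] in
/-- The minimizers of a least-squares cost grow at most linearly with the perturbation of the
data. -/
lemma exists_norm_minimizer_le {c : ℝ} (hc : 0 < c) (hBc : ∀ X, c * ‖X‖ ^ 2 ≤ B X X)
    {Dom : Set E} {R : V} {θ₀ : E} (hθ₀ : θ₀ ∈ Dom) {c₁ : ℝ}
    (hcoer : ∀ θ ∈ Dom, ‖θ‖ ≤ c₁ * (1 + ‖S θ‖)) :
    ∃ C : ℝ, 0 < C ∧ ∀ Δ : V, ∀ θ ∈ Dom, IsMinOn (lsCost B S (R + Δ)) Dom θ →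
      ‖S θ‖ ≤ C * (1 + ‖Δ‖) ∧ ‖θ‖ ≤ C * (1 + ‖Δ‖) := by
  set κ := 1 + ‖B‖ / c with hκ
  have hκ0 : 0 ≤ κ := by positivity
  set C₁ := (1 + κ) * (1 + ‖R‖ + ‖S θ₀‖) with hC₁
  have hC₁1 : 1 ≤ C₁ := by
    have := norm_nonneg R
    have := norm_nonneg (S θ₀)
    nlinarith
  have hS : ∀ Δ : V, ∀ θ ∈ Dom, IsMinOn (lsCost B S (R + Δ)) Dom θ →
      ‖S θ‖ ≤ C₁ * (1 + ‖Δ‖) := by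
    intro Δ θ hθ hmin
    have h1 : B (R + Δ - S θ) (R + Δ - S θ) ≤ B (R + Δ - S θ₀) (R + Δ - S θ₀) := by
      have := hmin hθ₀
      simp only [Set.mem_ofPred_eq, lsCost] at this
      linarith
    have h2 : B (R + Δ - S θ₀) (R + Δ - S θ₀) ≤ ‖B‖ * ‖R + Δ - S θ₀‖ ^ 2 := by
      have := (le_abs_self _).trans (B.le_opNorm₂ (R + Δ - S θ₀) (R + Δ - S θ₀))
      rwa [mul_assoc, ← pow_two] at this
    have h3 : ‖R + Δ - S θ‖ ≤ κ * ‖R + Δ - S θ₀‖ := by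
      refine (pow_le_pow_iff_left₀ (norm_nonneg _) (by positivity) two_ne_zero).1 ?_
      have h4 : ‖R + Δ - S θ‖ ^ 2 ≤ ‖B‖ / c * ‖R + Δ - S θ₀‖ ^ 2 := by
        rw [div_mul_eq_mul_div, le_div_iff₀ hc]
        linarith [hBc (R + Δ - S θ)]
      refine h4.trans ?_
      rw [mul_pow]
      gcongr
      have : 0 ≤ ‖B‖ / c := by positivity
      nlinarith
    have h5 : ‖S θ‖ ≤ ‖R + Δ‖ + ‖R + Δ - S θ‖ := by
      have := norm_sub_le (R + Δ) (R + Δ - S θ)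
      rwa [sub_sub_cancel] at this
    have h6 : ‖R + Δ‖ ≤ ‖R‖ + ‖Δ‖ := norm_add_le _ _
    have h7 : ‖R + Δ - S θ₀‖ ≤ ‖R‖ + ‖Δ‖ + ‖S θ₀‖ := (norm_sub_le _ _).trans (by gcongr)
    have h8 : κ * ‖R + Δ - S θ₀‖ ≤ κ * (‖R‖ + ‖Δ‖ + ‖S θ₀‖) := by gcongr
    calc ‖S θ‖ ≤ (1 + κ) * (‖R‖ + ‖Δ‖ + ‖S θ₀‖) := by linarith [norm_nonneg (S θ₀)]
      _ ≤ (1 + κ) * ((1 + ‖R‖ + ‖S θ₀‖) * (1 + ‖Δ‖)) := by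
        gcongr
        have : 0 ≤ (‖R‖ + ‖S θ₀‖) * ‖Δ‖ := by positivity
        nlinarith
      _ = C₁ * (1 + ‖Δ‖) := by rw [hC₁]; ring
  refine ⟨C₁ + |c₁| * (1 + C₁), by positivity, fun Δ θ hθ hmin => ⟨?_, ?_⟩⟩
  · refine (hS Δ θ hθ hmin).trans ?_
    gcongr
    have : 0 ≤ |c₁| * (1 + C₁) := by positivity
    linarith
  · calc ‖θ‖ ≤ c₁ * (1 + ‖S θ‖) := hcoer θ hθ
      _ ≤ |c₁| * (1 + C₁ * (1 + ‖Δ‖)) := by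
        gcongr
        · exact le_abs_self _
        · exact hS Δ θ hθ hmin
      _ ≤ |c₁| * ((1 + C₁) * (1 + ‖Δ‖)) := by
        gcongr
        nlinarith [norm_nonneg Δ]
      _ ≤ (C₁ + |c₁| * (1 + C₁)) * (1 + ‖Δ‖) := by
        rw [← mul_assoc]
        gcongr
        linarith

/-- Consistency: the minimizer of the perturbed cost is close to the unique minimizer `θ₀` when
the perturbation is small. -/
lemma exists_norm_minimizer_sub_lt [FiniteDimensional ℝ E] (hB : ∀ X Y, B X Y = B Y X)
    {c : ℝ} (hc : 0 < c) (hBc : ∀ X, c * ‖X‖ ^ 2 ≤ B X X) (hS : Continuous S)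
    {Dom : Set E} (hDom : IsClosed Dom) {R : V} {θ₀ : E} (hθ₀ : θ₀ ∈ Dom)
    (hmin₀ : IsMinOn (lsCost B S R) Dom θ₀)
    (huniq : ∀ θ ∈ Dom, lsCost B S R θ = lsCost B S R θ₀ → θ = θ₀) {c₁ : ℝ}
    (hcoer : ∀ θ ∈ Dom, ‖θ‖ ≤ c₁ * (1 + ‖S θ‖)) {r : ℝ} (hr : 0 < r) :
    ∃ δ : ℝ, 0 < δ ∧ ∀ Δ : V, ‖Δ‖ ≤ δ → ∀ θ ∈ Dom, IsMinOn (lsCost B S (R + Δ)) Dom θ →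
      ‖θ - θ₀‖ < r := by
  obtain ⟨C, hC0, hC⟩ := exists_norm_minimizer_le (R := R) hc hBc hθ₀ hcoer
  have hproper : ProperSpace E := FiniteDimensional.proper ℝ E
  set Z := Metric.closedBall (0 : E) (C * 2) ∩ (Dom ∩ {θ | r ≤ ‖θ - θ₀‖}) with hZ
  have hcont : Continuous (lsCost B S R) := by
    unfold lsCost
    have : Continuous fun θ => R - S θ := continuous_const.sub hS
    exact continuous_const.mul (B.isBoundedBilinearMap.continuous.comp (this.prodMk this))
  have hZc : IsCompact Z := (isCompact_closedBall _ _).inter_right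
    (hDom.inter (isClosed_le continuous_const (by fun_prop)))
  obtain ⟨η, hη, hηZ⟩ : ∃ η : ℝ, 0 < η ∧ ∀ θ ∈ Z, lsCost B S R θ₀ + η ≤ lsCost B S R θ := by
    rcases Z.eq_empty_or_nonempty with h | h
    · exact ⟨1, one_pos, by simp [h]⟩
    · obtain ⟨z, hz, hzmin⟩ := hZc.exists_isMinOn h hcont.continuousOn
      refine ⟨lsCost B S R z - lsCost B S R θ₀, ?_, fun θ hθ => by
        have := hzmin hθ
        simp only [Set.mem_ofPred_eq] at this
        linarith⟩
      have hle : lsCost B S R θ₀ ≤ lsCost B S R z := hmin₀ hz.2.1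
      refine sub_pos.2 (lt_of_le_of_ne hle fun heq => ?_)
      have hzr : r ≤ ‖z - θ₀‖ := hz.2.2
      rw [huniq z hz.2.1 heq.symm, sub_self, norm_zero] at hzr
      linarith
  set A := ‖B‖ * (C * 2 + ‖S θ₀‖) + 1 with hA
  have hA0 : 0 < A := by positivity
  refine ⟨min 1 (η / (2 * A)), by positivity, fun Δ hΔ θ hθ hmin => ?_⟩
  by_contra! hcon
  have hΔ1 : ‖Δ‖ ≤ 1 := hΔ.trans (min_le_left _ _)
  have hΔ2 : ‖Δ‖ ≤ η / (2 * A) := hΔ.trans (min_le_right _ _)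
  obtain ⟨hSb, hθb⟩ := hC Δ θ hθ hmin
  have hC2 : C * (1 + ‖Δ‖) ≤ C * 2 := by gcongr; linarith
  have hge := hηZ θ ⟨by simpa using hθb.trans hC2, hθ, hcon⟩
  have hle : lsCost B S (R + Δ) θ ≤ lsCost B S (R + Δ) θ₀ := hmin hθ₀
  rw [lsCost_add hB, lsCost_add hB] at hle
  have hlin : B Δ (R - S θ₀) - B Δ (R - S θ) ≤ ‖Δ‖ * A := by
    rw [← map_sub, sub_sub_sub_cancel_left]
    calc B Δ (S θ - S θ₀) ≤ ‖B‖ * ‖Δ‖ * ‖S θ - S θ₀‖ :=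
          (le_abs_self _).trans (B.le_opNorm₂ _ _)
      _ ≤ ‖B‖ * ‖Δ‖ * (C * 2 + ‖S θ₀‖) := by
          gcongr
          exact (norm_sub_le _ _).trans (by gcongr; exact hSb.trans hC2)
      _ ≤ ‖Δ‖ * A := by rw [hA]; nlinarith [norm_nonneg Δ]
  have : ‖Δ‖ * A ≤ η / 2 := by
    calc ‖Δ‖ * A ≤ η / (2 * A) * A := by gcongr
      _ = η / 2 := by field_simp
  linarith

/-- Linearization of the minimizer. If `θ₀` is the unique minimizer of the cost for the data `R`
and the Hessian there is invertible, then every minimizer for the data `R + Δ` is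
`θ₀ + T Δ + O(‖Δ‖ ^ 2)`, where `T` is what implicit differentiation of the critical point equation
gives for the derivative of the minimizer. The bound is uniform in `Δ`: for large `Δ` it comes from
coercivity. -/
theorem exists_norm_minimizer_sub_sub_le [FiniteDimensional ℝ E] (hB : ∀ X Y, B X Y = B Y X)
    {c : ℝ} (hc : 0 < c) (hBc : ∀ X, c * ‖X‖ ^ 2 ≤ B X X) (hS : ContDiff ℝ 3 S)
    {Dom : Set E} (hDom : IsClosed Dom) {R : V} {θ₀ : E} (hθ₀ : Dom ∈ 𝓝 θ₀)
    (hmin₀ : IsMinOn (lsCost B S R) Dom θ₀)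
    (huniq : ∀ θ ∈ Dom, lsCost B S R θ = lsCost B S R θ₀ → θ = θ₀) {c₁ : ℝ}
    (hcoer : ∀ θ ∈ Dom, ‖θ‖ ≤ c₁ * (1 + ‖S θ‖))
    (hinj : Function.Injective (fderiv ℝ (lsGrad B S R) θ₀)) {T : V →L[ℝ] E}
    (hT : ∀ Δ, fderiv ℝ (lsGrad B S R) θ₀ (T Δ) = (B Δ).comp (fderiv ℝ S θ₀)) :
    ∃ C : ℝ, 0 ≤ C ∧ ∀ Δ : V, ∀ θ ∈ Dom, IsMinOn (lsCost B S (R + Δ)) Dom θ →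
      ‖θ - θ₀ - T Δ‖ ≤ C * ‖Δ‖ ^ 2 := by
  have hθ₀Dom : θ₀ ∈ Dom := mem_of_mem_nhds hθ₀
  have hSd : Differentiable ℝ S := hS.differentiable (by norm_num)
  set Hb := fderiv ℝ (lsGrad B S R) θ₀ with hHb
  obtain ⟨h, hh, hHbound⟩ : ∃ h : ℝ, 0 < h ∧ ∀ e, ‖e‖ ≤ h * ‖Hb e‖ := by
    obtain ⟨k, hk, hanti⟩ := (Hb : E →ₗ[ℝ] (E →L[ℝ] ℝ)).exists_antilipschitzWith
      (LinearMap.ker_eq_bot.2 hinj)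
    exact ⟨k, hk, fun e => by simpa using hanti.le_mul_dist e 0⟩
  have hg0 : lsGrad B S R θ₀ = 0 :=
    (hmin₀.isLocalMin hθ₀).hasFDerivAt_eq_zero (hasFDerivAt_lsCost hB hSd R θ₀)
  obtain ⟨K₁, r₁, hK₁, hr₁, hT₁⟩ := exists_norm_sub_sub_fderiv_le
    (contDiff_lsGrad (n := 2) (B := B) (by exact_mod_cast hS) R) θ₀
  have hSd2 : DifferentiableAt ℝ (fderiv ℝ S) θ₀ :=
    (hS.fderiv_right (m := 2) (by norm_num)).differentiable (by norm_num) θ₀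
  obtain ⟨K₂, hK₂, hT₂'⟩ := hSd2.isBigO_sub.exists_nonneg
  obtain ⟨r₂, hr₂, hT₂⟩ := Metric.eventually_nhds_iff.1 hT₂'.bound
  obtain ⟨r₃, hr₃, hT₃⟩ := Metric.mem_nhds_iff.1 hθ₀
  set K := h * (K₁ + ‖B‖ * K₂) with hK
  have hK0 : 0 ≤ K := by positivity
  set r := min (min r₁ r₂) (min r₃ (1 / (2 * (K + 1)))) with hr
  have hr0 : 0 < r := by positivity
  obtain ⟨δ, hδ, hcons⟩ := exists_norm_minimizer_sub_lt hB hc hBc hS.continuous hDom hθ₀Dom hmin₀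
    huniq hcoer hr0
  obtain ⟨C₀, hC₀, hgrow⟩ := exists_norm_minimizer_le (R := R) hc hBc hθ₀Dom hcoer
  set L := 2 * (‖T‖ + 1) with hL
  have hL0 : 0 ≤ L := by positivity
  set C₄ := C₀ + ‖θ₀‖ + ‖T‖ with hC₄
  have hC₄0 : 0 ≤ C₄ := by positivity
  refine ⟨K * (L ^ 2 + L) + C₄ * (δ⁻¹ ^ 2 + δ⁻¹), by positivity, fun Δ θ hθ hmin => ?_⟩
  rcases le_or_gt ‖Δ‖ δ with hsmall | hlarge
  · set e := θ - θ₀ with he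
    have her : ‖e‖ < r := hcons Δ hsmall θ hθ hmin
    have he1 : ‖e‖ < r₁ := her.trans_le ((min_le_left _ _).trans (min_le_left _ _))
    have he2 : ‖e‖ < r₂ := her.trans_le ((min_le_left _ _).trans (min_le_right _ _))
    have he3 : ‖e‖ < r₃ := her.trans_le ((min_le_right _ _).trans (min_le_left _ _))
    have he4 : ‖e‖ < 1 / (2 * (K + 1)) :=
      her.trans_le ((min_le_right _ _).trans (min_le_right _ _))
    have hDomθ : Dom ∈ 𝓝 θ := mem_of_superset
      (Metric.isOpen_ball.mem_nhds (show θ ∈ Metric.ball θ₀ r₃ by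
        rwa [Metric.mem_ball, dist_eq_norm])) hT₃
    have hg : lsGrad B S (R + Δ) θ = 0 :=
      (hmin.isLocalMin hDomθ).hasFDerivAt_eq_zero (hasFDerivAt_lsCost hB hSd _ θ)
    have hsplit : Hb (e - T Δ) =
        (B Δ).comp (fderiv ℝ S θ - fderiv ℝ S θ₀) - (lsGrad B S R θ - lsGrad B S R θ₀ - Hb e) := by
      have : lsGrad B S R θ - (B Δ).comp (fderiv ℝ S θ) = 0 := by
        rw [← hg]
        ext y
        simp only [lsGrad, add_sub_right_comm, map_add, _root_.add_apply, _root_.sub_apply,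
          _root_.neg_apply, ContinuousLinearMap.comp_apply]
        ring
      rw [map_sub, hT, hg0, sub_eq_zero.1 this, ContinuousLinearMap.comp_sub]
      abel
    have hbound : ‖e - T Δ‖ ≤ K * (‖e‖ ^ 2 + ‖Δ‖ * ‖e‖) := by
      have b1 : ‖(B Δ).comp (fderiv ℝ S θ - fderiv ℝ S θ₀)‖ ≤ ‖B‖ * ‖Δ‖ * (K₂ * ‖e‖) := by
        refine (ContinuousLinearMap.opNorm_comp_le _ _).trans ?_
        gcongr
        · exact B.le_opNorm _
        · exact hT₂ (by rwa [dist_eq_norm])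
      have b2 := hT₁ θ he1
      calc ‖e - T Δ‖ ≤ h * ‖Hb (e - T Δ)‖ := hHbound _
        _ ≤ h * (‖B‖ * ‖Δ‖ * (K₂ * ‖e‖) + K₁ * ‖e‖ ^ 2) := by
          rw [hsplit]
          gcongr
          exact (norm_sub_le _ _).trans (add_le_add b1 b2)
        _ ≤ K * (‖e‖ ^ 2 + ‖Δ‖ * ‖e‖) := by
          rw [hK]
          have h1 : 0 ≤ h * (K₁ * (‖Δ‖ * ‖e‖)) := by positivity
          have h2 : 0 ≤ h * (‖B‖ * K₂ * ‖e‖ ^ 2) := by positivity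
          linarith
    have hKe : K * ‖e‖ ≤ 1 / 2 := by
      calc K * ‖e‖ ≤ (K + 1) * (1 / (2 * (K + 1))) := by gcongr; linarith
        _ = 1 / 2 := by field_simp
    -- The radius `r` is such that the quadratic remainder is absorbed: `‖e‖ ≤ L ‖Δ‖`.
    have heL : ‖e‖ ≤ L * ‖Δ‖ := by
      have h1 : ‖e‖ ≤ ‖e - T Δ‖ + ‖T‖ * ‖Δ‖ := by
        calc ‖e‖ = ‖(e - T Δ) + T Δ‖ := by rw [sub_add_cancel]
          _ ≤ _ := (norm_add_le _ _).trans (by gcongr; exact T.le_opNorm _)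
      have h2 : K * (‖e‖ ^ 2 + ‖Δ‖ * ‖e‖) ≤ 1 / 2 * (‖e‖ + ‖Δ‖) := by
        calc K * (‖e‖ ^ 2 + ‖Δ‖ * ‖e‖) = K * ‖e‖ * (‖e‖ + ‖Δ‖) := by ring
          _ ≤ _ := by gcongr
      rw [hL]
      linarith [norm_nonneg Δ]
    calc ‖e - T Δ‖ ≤ K * (‖e‖ ^ 2 + ‖Δ‖ * ‖e‖) := hbound
      _ ≤ K * ((L * ‖Δ‖) ^ 2 + ‖Δ‖ * (L * ‖Δ‖)) := by gcongr
      _ = K * (L ^ 2 + L) * ‖Δ‖ ^ 2 := by ring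
      _ ≤ _ := by
        gcongr
        have : 0 ≤ C₄ * (δ⁻¹ ^ 2 + δ⁻¹) := by positivity
        linarith
  · have h1 : 1 ≤ δ⁻¹ * ‖Δ‖ := by
      rw [inv_mul_eq_div, one_le_div hδ]; exact hlarge.le
    calc ‖θ - θ₀ - T Δ‖ ≤ C₀ * (1 + ‖Δ‖) + ‖θ₀‖ + ‖T‖ * ‖Δ‖ := by
          refine (norm_sub_le _ _).trans (add_le_add ((norm_sub_le _ _).trans ?_) (T.le_opNorm _))
          gcongr
          exact (hgrow Δ θ hθ hmin).2
      _ ≤ C₄ * (1 + ‖Δ‖) := by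
        rw [hC₄]
        nlinarith [norm_nonneg T, norm_nonneg Δ, mul_nonneg (norm_nonneg θ₀) (norm_nonneg Δ)]
      _ ≤ C₄ * ((δ⁻¹ * ‖Δ‖) ^ 2 + (δ⁻¹ * ‖Δ‖) * ‖Δ‖) := by
        gcongr
        · exact one_le_pow₀ h1
        · exact le_mul_of_one_le_left (norm_nonneg _) h1
      _ = C₄ * (δ⁻¹ ^ 2 + δ⁻¹) * ‖Δ‖ ^ 2 := by ring
      _ ≤ _ := by
        gcongr
        have : 0 ≤ K * (L ^ 2 + L) := by positivity
        linarith

end Perturbation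

/-! ### The weighted inner product -/

section WeightedForm

open scoped MatrixOrder in
lemma exists_isHermitian_mul_self_eq {n : ℕ} {W : Matrix (Fin n) (Fin n) ℂ} (hW : W.PosDef) :
    ∃ S : Matrix (Fin n) (Fin n) ℂ, S.IsHermitian ∧ S * S = W :=
  ⟨CFC.sqrt W, (Matrix.nonneg_iff_posSemidef.1 (CFC.sqrt_nonneg W)).isHermitian,
    CFC.sqrt_mul_sqrt_self W hW.posSemidef.nonneg⟩

lemma exists_norm_linearMap_le {E F : Type*} [NormedAddCommGroup E] [NormedSpace ℝ E]
    [FiniteDimensional ℝ E] [NormedAddCommGroup F] [NormedSpace ℝ F] (L : E →ₗ[ℝ] F) :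
    ∃ C : ℝ, 0 < C ∧ ∀ x, ‖L x‖ ≤ C * ‖x‖ :=
  L.toContinuousLinearMap.bound

open scoped Matrix.Norms.Elementwise

variable {M : ℕ} {W : Matrix (Fin M) (Fin M) ℂ}

/-- The real bilinear form `Re tr (W X W Yᴴ)`, whose quadratic form is `weightedNormSq W`. -/
noncomputable def weightedForm (W : Matrix (Fin M) (Fin M) ℂ) :
    Matrix (Fin M) (Fin M) ℂ →L[ℝ] Matrix (Fin M) (Fin M) ℂ →L[ℝ] ℝ :=
  (LinearMap.mk₂ ℝ (fun X Y => (W * X * W * Yᴴ).trace.re)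
    (by intros; simp [Matrix.mul_add, Matrix.add_mul])
    (by intros; simp)
    (by intros; simp [Matrix.mul_add])
    (by intros; simp [Matrix.conjTranspose_smul])).toContinuousBilinearMap

lemma weightedForm_apply (X Y : Matrix (Fin M) (Fin M) ℂ) :
    weightedForm W X Y = (W * X * W * Yᴴ).trace.re := rfl

lemma weightedForm_comm (hW : W.IsHermitian) (X Y : Matrix (Fin M) (Fin M) ℂ) :
    weightedForm W X Y = weightedForm W Y X := by
  have h : star (W * X * W * Yᴴ).trace = (W * Y * W * Xᴴ).trace := by
    rw [← Matrix.trace_conjTranspose]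
    simp only [Matrix.conjTranspose_mul, Matrix.conjTranspose_conjTranspose, hW.eq]
    rw [← Matrix.mul_assoc, Matrix.trace_mul_comm]
    simp only [Matrix.mul_assoc]
    rw [Matrix.trace_mul_comm]
    simp only [Matrix.mul_assoc]
  rw [weightedForm_apply, weightedForm_apply, ← h]
  simp

/-- On Hermitian matrices the weighted form is a trace, without taking the real part. -/
lemma ofReal_weightedForm (hW : W.IsHermitian) {X Y : Matrix (Fin M) (Fin M) ℂ}
    (hX : X.IsHermitian) (hY : Y.IsHermitian) :
    ((weightedForm W X Y : ℝ) : ℂ) = (W * X * W * Y).trace := by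
  rw [weightedForm_apply, hY.eq]
  refine Complex.conj_eq_iff_re.1 ?_
  rw [← Complex.star_def, ← Matrix.trace_conjTranspose]
  simp only [Matrix.conjTranspose_mul, hW.eq, hX.eq, hY.eq]
  rw [Matrix.trace_mul_comm, Matrix.mul_assoc W X W, Matrix.mul_assoc W,
    Matrix.trace_mul_comm W]

lemma exists_mul_sq_norm_le_weightedForm (hW : W.PosDef) :
    ∃ c : ℝ, 0 < c ∧ ∀ X, c * ‖X‖ ^ 2 ≤ weightedForm W X X := by
  obtain ⟨S, hSh, hSS⟩ := exists_isHermitian_mul_self_eq hW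
  have hSu : IsUnit S.det := by
    have : IsUnit W.det := (Matrix.isUnit_iff_isUnit_det W).1 hW.isUnit
    rw [← hSS, Matrix.det_mul] at this
    exact isUnit_of_mul_isUnit_left this
  -- `X = S⁻¹ (S X S) S⁻¹` bounds `‖X‖` by `‖S X S‖`.
  obtain ⟨C, hC, hCX⟩ := exists_norm_linearMap_le
    ((LinearMap.mulLeft ℝ S⁻¹).comp (LinearMap.mulRight ℝ S⁻¹))
  have hLX : ∀ X, ‖X‖ ≤ C * ‖S * X * S‖ := by
    intro X
    refine le_of_eq_of_le ?_ (hCX (S * X * S))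
    rw [LinearMap.comp_apply, LinearMap.mulRight_apply, LinearMap.mulLeft_apply,
      Matrix.mul_nonsing_inv_cancel_right _ _ hSu,
      Matrix.nonsing_inv_mul_cancel_left _ _ hSu]
  have hF : ∀ Y : Matrix (Fin M) (Fin M) ℂ, ‖Y‖ ^ 2 ≤ ∑ k, ∑ l, ‖Y k l‖ ^ 2 := by
    intro Y
    have h0 : 0 ≤ ∑ k, ∑ l, ‖Y k l‖ ^ 2 := by positivity
    refine (Real.le_sqrt (norm_nonneg _) h0).1 ((Matrix.norm_le_iff (Real.sqrt_nonneg _)).2 ?_)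
    intro i j
    refine Real.le_sqrt_of_sq_le ?_
    calc ‖Y i j‖ ^ 2 ≤ ∑ l, ‖Y i l‖ ^ 2 :=
          Finset.single_le_sum (f := fun l => ‖Y i l‖ ^ 2) (fun _ _ => by positivity)
            (Finset.mem_univ j)
      _ ≤ _ := Finset.single_le_sum (f := fun k => ∑ l, ‖Y k l‖ ^ 2) (fun _ _ => by positivity)
            (Finset.mem_univ i)
  refine ⟨1 / C ^ 2, by positivity, fun X => ?_⟩
  rw [one_div, inv_mul_le_iff₀ (by positivity)]
  have e : weightedForm W X X = ∑ k, ∑ l, ‖(S * X * S) k l‖ ^ 2 := by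
    rw [← weightedNormSq_eq S X hSh, hSS]; rfl
  rw [e]
  calc ‖X‖ ^ 2 ≤ (C * ‖S * X * S‖) ^ 2 := by gcongr; exact hLX X
    _ ≤ _ := by
      rw [mul_pow]
      gcongr
      exact hF _

end WeightedForm

/-! ### The covariance model -/

section Model

open scoped Matrix.Norms.Elementwise

variable {M D : ℕ} {u : Fin M → ℝ} {W : Matrix (Fin M) (Fin M) ℂ}

lemma cost_eq_lsCost (C : Matrix (Fin M) (Fin M) ℂ) :
    cost (D := D) u W C = lsCost (weightedForm W) (covModel u) C := rfl

lemma contDiff_covModel (n : ℕ) :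
    ContDiff ℝ n (covModel u : (Param D → ℝ) → Matrix (Fin M) (Fin M) ℂ) := by
  have hp : ∀ k : Param D, ContDiff ℝ n fun θ : Param D → ℝ => ((θ k : ℝ) : ℂ) := fun k =>
    Complex.ofRealCLM.contDiff.comp (contDiff_apply ℝ ℝ k)
  have hs : ∀ i, ContDiff ℝ n fun θ : Param D → ℝ => steering u (θ .omega) i := fun i =>
    (contDiff_const.mul (hp _)).cexp
  refine contDiff_pi.2 fun i => contDiff_pi.2 fun j => ?_
  simp only [covModel, Matrix.hadamard_apply, steeringOuter, Matrix.vecMulVec_apply, Pi.star_apply,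
    shapeModel, Matrix.add_apply, Matrix.smul_apply, Matrix.sum_apply, smul_eq_mul]
  refine ((hs i).mul ((Complex.conjCLE : ℂ →L[ℝ] ℂ).contDiff.comp (hs j))).mul
    (((hp _).mul contDiff_const).add (ContDiff.sum fun d _ => ?_) |>.add
      ((hp _).mul contDiff_const))
  exact ((hp _).mul contDiff_const).mul contDiff_const

lemma differentiable_covModel :
    Differentiable ℝ (covModel u : (Param D → ℝ) → Matrix (Fin M) (Fin M) ℂ) :=
  (contDiff_covModel 1).differentiable (by norm_num)

lemma geomPow_apply_swap (d : ℕ) (k l : Fin M) :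
    geomPow u d l k = (-1) ^ d * geomPow u d k l := by
  simp only [geomPow, Matrix.of_apply]
  rw [← neg_sub, neg_pow]
  push_cast
  ring

lemma isHermitian_covModel (θ : Param D → ℝ) : (covModel u θ).IsHermitian := by
  ext k l
  have hg : ∀ d : ℕ, star (Complex.I ^ d / (Nat.factorial d : ℂ) * geomPow u d l k) =
      Complex.I ^ d / (Nat.factorial d : ℂ) * geomPow u d k l := by
    intro d
    rw [geomPow_apply_swap]
    simp only [geomPow, Matrix.of_apply, Complex.star_def, map_mul, map_div₀, map_pow,
      Complex.conj_I, map_natCast, Complex.conj_ofReal, map_neg, map_one]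
    rw [neg_pow Complex.I]
    have : ((-1 : ℂ) ^ d) * (-1) ^ d = 1 := by rw [← mul_pow]; simp
    linear_combination (Complex.I ^ d / (Nat.factorial d : ℂ) *
      (((u k - u l) ^ d : ℝ) : ℂ)) * this
  have h0 : star (geomPow u 0 l k) = geomPow u 0 k l := by simp [geomPow]
  have h1 : star ((1 : Matrix (Fin M) (Fin M) ℂ) l k) = (1 : Matrix (Fin M) (Fin M) ℂ) k l := by
    rw [← Matrix.conjTranspose_apply, Matrix.conjTranspose_one]
  simp only [covModel, Matrix.conjTranspose_apply, Matrix.hadamard_apply, steeringOuter,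
    Matrix.vecMulVec_apply, Pi.star_apply, shapeModel, Matrix.add_apply, Matrix.smul_apply,
    Matrix.sum_apply, smul_eq_mul, star_mul', star_star, star_add, star_sum, h0, h1]
  congr 1
  · ring
  · congr 1
    · congr 1
      · simp
      · refine Finset.sum_congr rfl fun d _ => ?_
        have := hg d
        rw [star_mul'] at this
        rw [Complex.star_def, Complex.conj_ofReal, mul_assoc, ← Complex.star_def, this, mul_assoc]
    · simp

/-- Derivatives of Hermitian-valued maps are Hermitian. -/
lemma isHermitian_fderiv {E : Type*} [NormedAddCommGroup E] [NormedSpace ℝ E]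
    {F : E → Matrix (Fin M) (Fin M) ℂ} {θ : E} (hF : DifferentiableAt ℝ F θ)
    (hH : ∀ θ, (F θ).IsHermitian) (e : E) : (fderiv ℝ F θ e).IsHermitian := by
  set L : Matrix (Fin M) (Fin M) ℂ →L[ℝ] Matrix (Fin M) (Fin M) ℂ :=
    ((Matrix.conjTransposeLinearEquiv (Fin M) (Fin M) ℝ ℂ).toLinearMap).toContinuousLinearMap
  have h : (fun θ => L (F θ)) = F := funext fun θ => (hH θ).eq
  have h1 := L.hasFDerivAt.comp θ hF.hasFDerivAt
  have h2 : fderiv ℝ F θ = L.comp (fderiv ℝ F θ) := by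
    conv_lhs => rw [← h]
    exact h1.fderiv
  exact (congrArg (fun G : E →L[ℝ] Matrix (Fin M) (Fin M) ℂ => G e) h2).symm

lemma partialDeriv_eq_fderiv {F : Type*} [NormedAddCommGroup F] [NormedSpace ℝ F]
    {G : (Param D → ℝ) → F} {θ : Param D → ℝ} (hG : DifferentiableAt ℝ G θ) (k : Param D) :
    partialDeriv k G θ = fderiv ℝ G θ (Pi.single k 1) :=
  hG.lineDeriv_eq_fderiv

lemma partialDeriv_entry {G : (Param D → ℝ) → Matrix (Fin M) (Fin M) ℂ} {θ : Param D → ℝ}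
    (hG : DifferentiableAt ℝ G θ) (k : Param D) (m n : Fin M) :
    partialDeriv k (fun θ' => G θ' m n) θ = fderiv ℝ G θ (Pi.single k 1) m n := by
  have h := hasFDerivAt_pi'.1 (hasFDerivAt_pi'.1 hG.hasFDerivAt m) n
  rw [partialDeriv_eq_fderiv h.differentiableAt, h.fderiv]
  rfl

lemma covModelD_eq (k : Param D) (θ : Param D → ℝ) :
    covModelD u k θ = fderiv ℝ (covModel u) θ (Pi.single k 1) := by
  ext m n
  exact partialDeriv_entry (differentiable_covModel θ) k m n

lemma differentiable_fderiv_covModel :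
    Differentiable ℝ (fderiv ℝ (covModel u : (Param D → ℝ) → Matrix (Fin M) (Fin M) ℂ)) :=
  ((contDiff_covModel 2).fderiv_right (m := 1) (by norm_num)).differentiable (by norm_num)

lemma covModelD2_eq (k l : Param D) (θ : Param D → ℝ) :
    covModelD2 u k l θ =
      fderiv ℝ (fderiv ℝ (covModel u)) θ (Pi.single k 1) (Pi.single l 1) := by
  ext m n
  simp only [covModelD2, Matrix.of_apply]
  have h1 : (partialDeriv l fun θ' : Param D → ℝ => covModel u θ' m n) =
      fun θ' => fderiv ℝ (covModel u) θ' (Pi.single l 1) m n :=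
    funext fun θ' => partialDeriv_entry (differentiable_covModel θ') l m n
  have h2 := hasFDerivAt_apply_const
    (differentiable_fderiv_covModel (u := u) θ).hasFDerivAt (Pi.single l (1 : ℝ))
  rw [h1]
  exact (partialDeriv_entry h2.differentiableAt k m n).trans
    (congrFun (congrFun (congrArg (fun L => L (Pi.single k 1)) h2.fderiv) m) n)

lemma isHermitian_covModelD (k : Param D) (θ : Param D → ℝ) : (covModelD u k θ).IsHermitian := by
  rw [covModelD_eq]
  exact isHermitian_fderiv (differentiable_covModel θ) isHermitian_covModel _

lemma isHermitian_covModelD2 (k l : Param D) (θ : Param D → ℝ) :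
    (covModelD2 u k l θ).IsHermitian := by
  have h2 := hasFDerivAt_apply_const
    (differentiable_fderiv_covModel (u := u) θ).hasFDerivAt (Pi.single l (1 : ℝ))
  have h3 := isHermitian_fderiv h2.differentiableAt
    (fun θ => isHermitian_fderiv (differentiable_covModel θ) isHermitian_covModel _)
    (Pi.single k 1)
  rw [covModelD2_eq]
  exact (congrArg (fun L => (L (Pi.single k 1)).IsHermitian) h2.fderiv).mp h3

lemma partialDeriv_cost (hW : W.IsHermitian) (C : Matrix (Fin M) (Fin M) ℂ) (k : Param D)
    (θ : Param D → ℝ) :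
    partialDeriv k (cost u W C) θ = -weightedForm W (C - covModel u θ) (covModelD u k θ) := by
  have h := hasFDerivAt_lsCost (weightedForm_comm hW) differentiable_covModel C θ (S := covModel u)
  rw [cost_eq_lsCost, partialDeriv_eq_fderiv h.differentiableAt, h.fderiv, covModelD_eq]
  rfl

lemma hessian_cost_eq_fderiv_lsGrad (hW : W.IsHermitian) (C : Matrix (Fin M) (Fin M) ℂ)
    (θ : Param D → ℝ) (k l : Param D) :
    hessian (cost u W C) θ k l =
      fderiv ℝ (lsGrad (weightedForm W) (covModel u) C) θ (Pi.single k 1) (Pi.single l 1) := by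
  have h1 : partialDeriv l (cost u W C) =
      fun θ : Param D → ℝ => lsGrad (weightedForm W) (covModel u) C θ (Pi.single l 1) :=
    funext fun θ => by
      have h := hasFDerivAt_lsCost (weightedForm_comm hW) differentiable_covModel C θ
        (S := covModel u)
      rw [cost_eq_lsCost, partialDeriv_eq_fderiv h.differentiableAt, h.fderiv]
  have h0 : DifferentiableAt ℝ (lsGrad (weightedForm W) (covModel (D := D) u) C) θ :=
    (contDiff_lsGrad (n := 1) (contDiff_covModel _) C).differentiable (by norm_num) θ
  have h2 := hasFDerivAt_apply_const h0.hasFDerivAt (Pi.single l (1 : ℝ))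
  rw [hessian, Matrix.of_apply, h1, partialDeriv_eq_fderiv h2.differentiableAt, h2.fderiv]
  rfl

lemma hessian_cost_apply (hW : W.IsHermitian) (C : Matrix (Fin M) (Fin M) ℂ)
    (θ : Param D → ℝ) (k l : Param D) :
    hessian (cost u W C) θ k l =
      weightedForm W (covModelD2 u k l θ) (covModel u θ - C) +
        weightedForm W (covModelD u k θ) (covModelD u l θ) := by
  rw [hessian_cost_eq_fderiv_lsGrad hW, covModelD2_eq, covModelD_eq, covModelD_eq]
  exact fderiv_lsGrad_apply (weightedForm_comm hW) (contDiff_covModel 2) C θ _ _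

lemma hessian_cost_symm (hW : W.IsHermitian) (C : Matrix (Fin M) (Fin M) ℂ)
    (θ : Param D → ℝ) : (hessian (cost u W C) θ)ᵀ = hessian (cost u W C) θ := by
  have hsd : ∀ k l : Param D, covModelD2 u k l θ = covModelD2 u l k θ := fun k l => by
    rw [covModelD2_eq, covModelD2_eq]
    exact ((contDiff_covModel 2).contDiffAt.isSymmSndFDerivAt (by simp)).eq _ _
  ext k l
  rw [Matrix.transpose_apply, hessian_cost_apply hW, hessian_cost_apply hW, hsd,
    weightedForm_comm hW (covModelD u l θ)]

/-- The trace formula for the Hessian of the cost. -/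
lemma ofReal_hessian_cost (hW : W.IsHermitian) {C : Matrix (Fin M) (Fin M) ℂ}
    (hC : C.IsHermitian) (θ : Param D → ℝ) (k l : Param D) :
    ((hessian (cost u W C) θ k l : ℝ) : ℂ) =
      (W * covModelD2 u k l θ * W * (covModel u θ - C)).trace +
      (W * covModelD u k θ * W * covModelD u l θ).trace := by
  rw [hessian_cost_apply hW, Complex.ofReal_add,
    ofReal_weightedForm hW (isHermitian_covModelD2 k l θ) ((isHermitian_covModel θ).sub hC),
    ofReal_weightedForm hW (isHermitian_covModelD k θ) (isHermitian_covModelD l θ)]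

end Model

/-! ### Linearization of the estimator -/

section Estimator

open scoped Matrix.Norms.Elementwise

variable {M D : ℕ} {u : Fin M → ℝ} {W R : Matrix (Fin M) (Fin M) ℂ}

lemma norm_covModel (θ : Param D → ℝ) : ‖covModel u θ‖ = ‖shapeModel u θ‖ := by
  have h1 : ∀ k, ‖steering u (θ .omega) k‖ = 1 := fun k => by
    rw [steering, show Complex.I * u k * (θ .omega : ℝ) = ((u k * θ .omega : ℝ) : ℂ) * Complex.I by
      push_cast; ring, Complex.norm_exp_ofReal_mul_I]
  have h : ∀ k l, ‖covModel u θ k l‖ = ‖shapeModel u θ k l‖ := fun k l => by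
    simp [covModel, steeringOuter, Matrix.vecMulVec_apply, h1]
  refine le_antisymm ((Matrix.norm_le_iff (norm_nonneg _)).2 fun k l => ?_)
    ((Matrix.norm_le_iff (norm_nonneg _)).2 fun k l => ?_)
  · rw [h]; exact Matrix.norm_entry_le_entrywise_sup_norm _
  · rw [← h]; exact Matrix.norm_entry_le_entrywise_sup_norm _

lemma shapeModel_add (θ θ' : Param D → ℝ) :
    shapeModel u (θ + θ') = shapeModel u θ + shapeModel u θ' := by
  simp only [shapeModel, Pi.add_apply, Complex.ofReal_add, add_mul, add_smul,
    Finset.sum_add_distrib]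
  abel

lemma shapeModel_smul (c : ℝ) (θ : Param D → ℝ) :
    shapeModel u (c • θ) = c • shapeModel u θ := by
  simp only [shapeModel, Pi.smul_apply, smul_eq_mul, Complex.ofReal_mul, smul_add, Finset.smul_sum,
    mul_assoc, mul_smul, Complex.coe_smul]

/-- Uniqueness of the minimizer makes the linear part of the parametrization injective. Since the
steering factors are unimodular, the parameter is then controlled by the modelled covariance
matrix, uniformly over the compact angular domain. -/
lemma exists_norm_le_of_unique_minimizer {K : Set ℝ} (hK : IsCompact K) {θ₀ : Param D → ℝ}
    (hθ₀ : θ₀ .omega ∈ K)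
    (huniq : ∀ θ ∈ searchDomain D K, cost u W R θ = cost u W R θ₀ → θ = θ₀) :
    ∃ c : ℝ, ∀ θ ∈ searchDomain D K, ‖θ‖ ≤ c * (1 + ‖covModel u θ‖) := by
  set A : (Param D → ℝ) →ₗ[ℝ] ℝ × Matrix (Fin M) (Fin M) ℂ :=
    (LinearMap.proj .omega).prod ⟨⟨shapeModel u, shapeModel_add⟩, shapeModel_smul⟩ with hA
  have hker : LinearMap.ker A = ⊥ := by
    refine LinearMap.ker_eq_bot'.2 fun α hα => ?_
    have h1 : α .omega = 0 := congrArg Prod.fst hα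
    have h2 : shapeModel u α = 0 := congrArg Prod.snd hα
    have h3 : covModel u (θ₀ + α) = covModel u θ₀ := by
      simp only [covModel, shapeModel_add, Pi.add_apply, h1, h2, add_zero]
    have h4 := huniq (θ₀ + α) (by simpa [searchDomain, h1] using hθ₀) (by simp only [cost, h3])
    simpa using h4
  obtain ⟨k, -, hk⟩ := A.exists_antilipschitzWith hker
  obtain ⟨r, hr⟩ := hK.isBounded.exists_norm_le
  refine ⟨k * (|r| + 1), fun θ hθ => ?_⟩
  have h1 : ‖θ‖ ≤ k * ‖A θ‖ := by simpa using hk.le_mul_dist θ 0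
  have h2 : ‖A θ‖ ≤ |r| + ‖covModel u θ‖ := by
    rw [norm_covModel]
    refine max_le ((hr _ hθ).trans ?_) ?_
    · linarith [le_abs_self r, norm_nonneg (shapeModel u θ)]
    · exact le_add_of_nonneg_left (abs_nonneg r)
  calc ‖θ‖ ≤ k * (|r| + ‖covModel u θ‖) := h1.trans (by gcongr)
    _ ≤ k * ((|r| + 1) * (1 + ‖covModel u θ‖)) := by
      gcongr
      nlinarith [abs_nonneg r, norm_nonneg (covModel u θ),
        mul_nonneg (abs_nonneg r) (norm_nonneg (covModel u θ))]
    _ = _ := by ring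

lemma norm_le_sum_norm (X : Matrix (Fin M) (Fin M) ℂ) : ‖X‖ ≤ ∑ k, ∑ l, ‖X k l‖ := by
  refine (Matrix.norm_le_iff (by positivity)).2 fun i j => ?_
  calc ‖X i j‖ ≤ ∑ l, ‖X i l‖ :=
        Finset.single_le_sum (f := fun l => ‖X i l‖) (fun _ _ => norm_nonneg _) (Finset.mem_univ j)
    _ ≤ _ := Finset.single_le_sum (f := fun k => ∑ l, ‖X k l‖) (fun _ _ => by positivity)
        (Finset.mem_univ i)

lemma fderiv_lsGrad_apply_single (hW : W.IsHermitian) (θ₀ e : Param D → ℝ) (l : Param D) :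
    fderiv ℝ (lsGrad (weightedForm W) (covModel u) R) θ₀ e (Pi.single l 1) =
      (hessian (cost u W R) θ₀ *ᵥ e) l := by
  set Hb := fderiv ℝ (lsGrad (weightedForm W) (covModel (D := D) u) R) θ₀ with hHb
  have h : Hb e = ∑ k, e k • Hb (Pi.single k 1) := by
    have h1 : e = ∑ k, e k • (Pi.single k (1 : ℝ) : Param D → ℝ) :=
      pi_eq_sum_univ' e
    conv_lhs => rw [h1]
    simp only [map_sum, map_smul]
  rw [← hessian_cost_symm hW, h]
  simp only [_root_.sum_apply, Matrix.mulVec, dotProduct, Matrix.transpose_apply]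
  refine Finset.sum_congr rfl fun k _ => ?_
  rw [hessian_cost_eq_fderiv_lsGrad hW, mul_comm]
  rfl

lemma exists_continuousLinearMap_mulVec {ι V : Type*} [Fintype ι] [NormedAddCommGroup V]
    [NormedSpace ℝ V] (A : Matrix ι ι ℝ) (ψ : ι → V →L[ℝ] ℝ) :
    ∃ T : V →L[ℝ] (ι → ℝ), ∀ x, T x = A *ᵥ fun j => ψ j x := by
  refine ⟨ContinuousLinearMap.pi fun k => ∑ j, A k j • ψ j, fun x => ?_⟩
  ext k
  simp [Matrix.mulVec, dotProduct]

/-- Every minimizer of the cost for the data `R + Δ` is `θ₀ + H⁻¹ L Δ + O(‖Δ‖ ^ 2)`, uniformly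
in `Δ`, where `(L Δ) j` is the weighted inner product of `Δ` with `∂R̂/∂θ_j`. -/
theorem exists_abs_estimator_sub_le (hW : W.PosDef) {K : Set ℝ} (hK : IsCompact K)
    {θ₀ : Param D → ℝ} (hint : θ₀ .omega ∈ interior K)
    (hmin : IsMinOn (cost u W R) (searchDomain D K) θ₀)
    (huniq : ∀ θ ∈ searchDomain D K, cost u W R θ = cost u W R θ₀ → θ = θ₀)
    (hdet : IsUnit (hessian (cost u W R) θ₀).det) :
    ∃ C : ℝ, 0 ≤ C ∧ ∀ (Δ : Matrix (Fin M) (Fin M) ℂ), ∀ θ ∈ searchDomain D K,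
      IsMinOn (cost u W (R + Δ)) (searchDomain D K) θ → ∀ k,
      |θ k - θ₀ k - ∑ j, (hessian (cost u W R) θ₀)⁻¹ k j *
        weightedForm W Δ (covModelD u j θ₀)| ≤ C * (∑ k, ∑ l, ‖Δ k l‖) ^ 2 := by
  set H := hessian (cost u W R) θ₀ with hH
  have hWh := hW.isHermitian
  obtain ⟨c, hc, hBc⟩ := exists_mul_sq_norm_le_weightedForm hW
  obtain ⟨c₁, hcoer⟩ := exists_norm_le_of_unique_minimizer hK (interior_subset hint) huniq
  have hproj : Continuous fun θ : Param D → ℝ => θ .omega := continuous_apply _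
  obtain ⟨T, hTapp⟩ := exists_continuousLinearMap_mulVec H⁻¹
    fun j => (weightedForm W).flip (covModelD u j θ₀)
  obtain ⟨C, hC, hbound⟩ := exists_norm_minimizer_sub_sub_le (weightedForm_comm hWh) hc hBc
    (contDiff_covModel 3) (hK.isClosed.preimage hproj) (R := R) (θ₀ := θ₀)
    (mem_of_superset ((isOpen_interior.preimage hproj).mem_nhds hint)
      (Set.preimage_mono interior_subset)) hmin huniq hcoer
    ((injective_iff_map_eq_zero _).2 fun e he => by
      have h1 : H *ᵥ e = 0 := by
        ext l
        rw [hH, ← fderiv_lsGrad_apply_single hWh, he]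
        rfl
      have h2 := congrArg (fun v => H⁻¹ *ᵥ v) h1
      simpa [Matrix.mulVec_mulVec, Matrix.nonsing_inv_mul _ hdet] using h2)
    (T := T) (fun Δ => by
      have hb : ∀ l, fderiv ℝ (lsGrad (weightedForm W) (covModel u) R) θ₀ (T Δ) (Pi.single l 1) =
          (weightedForm W Δ).comp (fderiv ℝ (covModel u) θ₀) (Pi.single l 1) := by
        intro l
        rw [fderiv_lsGrad_apply_single hWh, hTapp, Matrix.mulVec_mulVec,
          Matrix.mul_nonsing_inv _ hdet, Matrix.one_mulVec, covModelD_eq]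
        rfl
      ext e
      rw [pi_eq_sum_univ' e]
      simp only [map_sum, map_smul]
      exact Finset.sum_congr rfl fun l _ => congrArg _ (hb l))
  refine ⟨C, hC, fun Δ θ hθ hθmin k => ?_⟩
  have h1 := (norm_le_pi_norm (θ - θ₀ - T Δ) k).trans (hbound Δ θ hθ hθmin)
  rw [Real.norm_eq_abs, Pi.sub_apply, Pi.sub_apply, hTapp] at h1
  refine h1.trans ?_
  gcongr
  exact norm_le_sum_norm Δ

end Estimator

/-! ### Fluctuations of the sample covariance matrix -/

section SampleCov

variable {M : ℕ} {Ω : Type*} [MeasurableSpace Ω] {μ : Measure Ω}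
  {R : Matrix (Fin M) (Fin M) ℂ} {x : ℕ → Ω → Fin M → ℂ}

/-- A bound for the eighth moments that depends on the covariance matrix only. -/
lemma IsCircularGaussian.integral_norm_pow_eight_le {X : Ω → Fin M → ℂ}
    (hX : IsCircularGaussian X R μ) (k : Fin M) :
    ∫ o, ‖X o k‖ ^ 8 ∂μ ≤ 16 * ∫ y, y ^ 8 ∂(gaussianReal 0 ((R k k).re / 2).toNNReal) := by
  have := hX.gaussian.isProbabilityMeasure
  obtain ⟨hre, him⟩ := hX.integral_re_im_pow k 8
  have hm := hX.hasAllMoments k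
  have hi1 := (hm.re.pow 8).integrable
  have hi2 := (hm.im.pow 8).integrable
  calc ∫ o, ‖X o k‖ ^ 8 ∂μ ≤ ∫ o, 8 * ((X o k).re ^ 8 + (X o k).im ^ 8) ∂μ := by
        refine integral_mono (hm.norm.pow 8).integrable ((hi1.add hi2).const_mul 8) fun o => ?_
        have h1 : ‖X o k‖ ^ 8 = ((X o k).re ^ 2 + (X o k).im ^ 2) ^ 4 := by
          rw [show ‖X o k‖ ^ 8 = (‖X o k‖ ^ 2) ^ 4 by ring, ← Complex.normSq_eq_norm_sq,
            Complex.normSq_apply]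
          ring
        have h2 := add_pow_le (sq_nonneg (X o k).re) (sq_nonneg (X o k).im) 4
        change ‖X o k‖ ^ 8 ≤ 8 * ((X o k).re ^ 8 + (X o k).im ^ 8)
        rw [h1]
        refine h2.trans_eq ?_
        norm_num
        ring
    _ = _ := by
        rw [integral_const_mul, integral_add hi1 hi2, hre, him]; ring

omit [MeasurableSpace Ω] in
lemma sampleCov_sub_apply {N : ℕ} (hN : 1 ≤ N) (o : Ω) (k l : Fin M) :
    (sampleCov x N o - R) k l =
      (N : ℝ)⁻¹ • ∑ t ∈ Finset.range N, (x t o k * star (x t o l) - R k l) := by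
  have hN0 : (N : ℂ) ≠ 0 := by exact_mod_cast (by omega : N ≠ 0)
  simp only [sampleCov, Matrix.sub_apply, Matrix.smul_apply, Matrix.sum_apply,
    Matrix.vecMulVec_apply, Pi.star_apply, smul_eq_mul, Finset.sum_sub_distrib, Finset.sum_const,
    Finset.card_range, nsmul_eq_mul, Complex.real_smul, Complex.ofReal_inv, Complex.ofReal_natCast]
  field_simp

lemma hasAllMoments_sampleCov_sub [IsProbabilityMeasure μ]
    (hgauss : ∀ t, IsCircularGaussian (x t) R μ) {N : ℕ} (hN : 1 ≤ N) (k l : Fin M) :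
    HasAllMoments (fun o => (sampleCov x N o - R) k l) μ := by
  simp only [sampleCov_sub_apply hN, Complex.real_smul]
  exact (HasAllMoments.sum _ fun t _ => (((hgauss t).hasAllMoments k).mul
    ((hgauss t).hasAllMoments l).star).sub (.const _)).const_mul _

lemma HasAllMoments.clm {f : Ω → ℂ} (hf : HasAllMoments f μ) (ψ : ℂ →L[ℝ] ℝ) :
    HasAllMoments (fun o => ψ (f o)) μ := fun p hp => ψ.comp_memLp' (hf p hp)

lemma exists_integral_clm_sampleCov_sub_pow_four_le [IsProbabilityMeasure μ]
    (hindep : iIndepFun x μ) (hgauss : ∀ t, IsCircularGaussian (x t) R μ) (ψ : ℂ →L[ℝ] ℝ)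
    (hψ : ∀ z, |ψ z| ≤ ‖z‖) (k l : Fin M) :
    ∃ κ : ℝ, ∀ N : ℕ, 1 ≤ N → ∫ o, ψ ((sampleCov x N o - R) k l) ^ 4 ∂μ ≤ κ / N ^ 2 := by
  set g : Fin M → ℝ := fun k => 16 * ∫ y, y ^ 8 ∂(gaussianReal 0 ((R k k).re / 2).toNNReal)
  set ξ : ℕ → Ω → ℝ := fun t o => ψ (x t o k * star (x t o l) - R k l) with hξ
  have hprod : ∀ t, HasAllMoments (fun o => x t o k * star (x t o l)) μ := fun t =>
    ((hgauss t).hasAllMoments k).mul ((hgauss t).hasAllMoments l).star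
  have hξm : ∀ t, HasAllMoments (ξ t) μ := fun t => ((hprod t).sub (.const _)).clm ψ
  have hξ0 : ∀ t, ∫ o, ξ t o ∂μ = 0 := fun t => by
    rw [ψ.integral_comp_comm ((hprod t).sub (.const _)).integrable,
      integral_sub (hprod t).integrable (integrable_const _), (hgauss t).cov_eq]
    simp
  have hξi : iIndepFun ξ μ :=
    hindep.comp (fun _ z => ψ (z k * star (z l) - R k l)) fun _ => by
      have : Continuous fun z : Fin M → ℂ => ψ (z k * star (z l) - R k l) := by fun_prop
      exact this.measurable
  have hξ4 : ∀ t, ∫ o, ξ t o ^ 4 ∂μ ≤ 4 * g k + 4 * g l + 8 * ‖R k l‖ ^ 4 := by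
    intro t
    have h8 : ∀ k, Integrable (fun o => ‖x t o k‖ ^ 8) μ := fun k =>
      (((hgauss t).hasAllMoments k).norm.pow 8).integrable
    calc ∫ o, ξ t o ^ 4 ∂μ ≤
        ∫ o, (4 * ‖x t o k‖ ^ 8 + 4 * ‖x t o l‖ ^ 8 + 8 * ‖R k l‖ ^ 4) ∂μ := by
          refine integral_mono ((hξm t).pow 4).integrable
            ((((h8 k).const_mul 4).add ((h8 l).const_mul 4)).add (integrable_const _)) fun o => ?_
          have h1 : |ξ t o| ≤ ‖x t o k‖ * ‖x t o l‖ + ‖R k l‖ := by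
            refine (hψ _).trans ((norm_sub_le _ _).trans_eq ?_)
            rw [norm_mul, norm_star]
          have h2 : ξ t o ^ 4 ≤ (‖x t o k‖ * ‖x t o l‖ + ‖R k l‖) ^ 4 := by
            rw [← Even.pow_abs (by decide : Even 4)]
            gcongr
          have h3 := add_pow_le (mul_nonneg (norm_nonneg (x t o k)) (norm_nonneg (x t o l)))
            (norm_nonneg (R k l)) 4
          change ξ t o ^ 4 ≤ 4 * ‖x t o k‖ ^ 8 + 4 * ‖x t o l‖ ^ 8 + 8 * ‖R k l‖ ^ 4
          norm_num at h3
          nlinarith [sq_nonneg (‖x t o k‖ ^ 4 - ‖x t o l‖ ^ 4)]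
      _ = 4 * ∫ o, ‖x t o k‖ ^ 8 ∂μ + 4 * ∫ o, ‖x t o l‖ ^ 8 ∂μ + 8 * ‖R k l‖ ^ 4 := by
          rw [integral_add (by fun_prop) (by fun_prop), integral_add (by fun_prop) (by fun_prop),
            integral_const_mul, integral_const_mul]
          simp
      _ ≤ _ := by
          have := (hgauss t).integral_norm_pow_eight_le k
          have := (hgauss t).integral_norm_pow_eight_le l
          gcongr
  refine ⟨3 * (4 * g k + 4 * g l + 8 * ‖R k l‖ ^ 4), fun N hN => ?_⟩
  have hN0 : (0 : ℝ) < N := by exact_mod_cast hN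
  have e : ∀ o, ψ ((sampleCov x N o - R) k l) ^ 4 =
      ((N : ℝ) ^ 4)⁻¹ * (∑ t ∈ Finset.range N, ξ t o) ^ 4 := fun o => by
    rw [sampleCov_sub_apply hN, map_smul, map_sum, smul_eq_mul, mul_pow, inv_pow]
  simp only [e]
  rw [integral_const_mul, inv_mul_le_iff₀ (by positivity)]
  refine (integral_sum_pow_four_le hξm hξi hξ0 hξ4 N).trans_eq ?_
  field_simp

/-- The sample covariance matrix fluctuates at scale `N ^ (-1/2)` in `L⁴`. -/
lemma exists_integral_sum_norm_sampleCov_sub_pow_four_le [IsProbabilityMeasure μ]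
    (hindep : iIndepFun x μ) (hgauss : ∀ t, IsCircularGaussian (x t) R μ) :
    ∃ κ : ℝ, ∀ N : ℕ, 1 ≤ N →
      ∫ o, (∑ k, ∑ l, ‖(sampleCov x N o - R) k l‖) ^ 4 ∂μ ≤ κ / N ^ 2 := by
  choose κ₁ hκ₁ using fun p : Fin M × Fin M => exists_integral_clm_sampleCov_sub_pow_four_le
    hindep hgauss Complex.reCLM (fun z => Complex.abs_re_le_norm z) p.1 p.2
  choose κ₂ hκ₂ using fun p : Fin M × Fin M => exists_integral_clm_sampleCov_sub_pow_four_le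
    hindep hgauss Complex.imCLM (fun z => Complex.abs_im_le_norm z) p.1 p.2
  set n : ℝ := ((Finset.univ : Finset (Fin M × Fin M)).card : ℝ) with hn
  refine ⟨n ^ 3 * ∑ p, 2 * (κ₁ p + κ₂ p), fun N hN => ?_⟩
  have hm := hasAllMoments_sampleCov_sub hgauss hN
  have hre : ∀ k l, Integrable (fun o => ((sampleCov x N o - R) k l).re ^ 4) μ := fun k l =>
    ((hm k l).re.pow 4).integrable
  have him : ∀ k l, Integrable (fun o => ((sampleCov x N o - R) k l).im ^ 4) μ := fun k l =>
    ((hm k l).im.pow 4).integrable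
  have hi : ∀ p : Fin M × Fin M, Integrable (fun o => 2 * (((sampleCov x N o - R) p.1 p.2).re ^ 4 +
      ((sampleCov x N o - R) p.1 p.2).im ^ 4)) μ := fun p =>
    ((hre _ _).add (him _ _)).const_mul 2
  calc ∫ o, (∑ k, ∑ l, ‖(sampleCov x N o - R) k l‖) ^ 4 ∂μ ≤
      ∫ o, n ^ 3 * ∑ p : Fin M × Fin M, 2 * (((sampleCov x N o - R) p.1 p.2).re ^ 4 +
        ((sampleCov x N o - R) p.1 p.2).im ^ 4) ∂μ := by
        refine integral_mono ((HasAllMoments.sum _ fun k _ => .sum _ fun l _ =>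
          (hm k l).norm).pow 4).integrable
          ((integrable_finsetSum _ fun p _ => hi p).const_mul _) fun o => ?_
        change (∑ k, ∑ l, ‖(sampleCov x N o - R) k l‖) ^ 4 ≤
          n ^ 3 * ∑ p : Fin M × Fin M, 2 * (((sampleCov x N o - R) p.1 p.2).re ^ 4 +
            ((sampleCov x N o - R) p.1 p.2).im ^ 4)
        rw [← Fintype.sum_prod_type' (f := fun k l => ‖(sampleCov x N o - R) k l‖)]
        refine (pow_sum_le_card_mul_sum_pow (fun _ _ => norm_nonneg _) 3).trans ?_
        rw [hn]
        gcongr with p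
        have h1 : ‖(sampleCov x N o - R) p.1 p.2‖ ^ 4 =
            (((sampleCov x N o - R) p.1 p.2).re ^ 2 +
              ((sampleCov x N o - R) p.1 p.2).im ^ 2) ^ 2 := by
          rw [show ∀ a : ℝ, a ^ 4 = (a ^ 2) ^ 2 from fun a => by ring,
            ← Complex.normSq_eq_norm_sq, Complex.normSq_apply]
          ring
        rw [show 3 + 1 = 4 from rfl, h1]
        nlinarith [sq_nonneg (((sampleCov x N o - R) p.1 p.2).re ^ 2 -
          ((sampleCov x N o - R) p.1 p.2).im ^ 2)]
    _ = n ^ 3 * ∑ p : Fin M × Fin M, 2 * (∫ o, ((sampleCov x N o - R) p.1 p.2).re ^ 4 ∂μ +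
        ∫ o, ((sampleCov x N o - R) p.1 p.2).im ^ 4 ∂μ) := by
        rw [integral_const_mul, integral_finsetSum _ fun p _ => hi p]
        congr 1
        refine Finset.sum_congr rfl fun p _ => ?_
        rw [integral_const_mul, integral_add (hre _ _) (him _ _)]
    _ ≤ n ^ 3 * ∑ p : Fin M × Fin M, 2 * (κ₁ p / N ^ 2 + κ₂ p / N ^ 2) := by
        gcongr with p
        · exact hκ₁ p N hN
        · exact hκ₂ p N hN
    _ = _ := by
        rw [mul_div_assoc, Finset.sum_div]
        congr 1
        refine Finset.sum_congr rfl fun p _ => ?_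
        ring

/-- The centred quadratic form `z ↦ Re (zᴴ A z) - Re tr (R A)`. -/
noncomputable def centredQuadForm (R A : Matrix (Fin M) (Fin M) ℂ) (z : Fin M → ℂ) : ℝ :=
  (star z ⬝ᵥ A *ᵥ z).re - (R * A).trace.re

lemma measurable_centredQuadForm (R A : Matrix (Fin M) (Fin M) ℂ) :
    Measurable (centredQuadForm R A) := by
  have : Continuous (centredQuadForm R A) := by
    unfold centredQuadForm
    simp only [dotProduct_mulVec_eq_sum]
    fun_prop
  exact this.measurable

lemma ofReal_centredQuadForm {A : Matrix (Fin M) (Fin M) ℂ} (hR : R.IsHermitian)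
    (hA : A.IsHermitian) (z : Fin M → ℂ) :
    ((centredQuadForm R A z : ℝ) : ℂ) = star z ⬝ᵥ A *ᵥ z - (R * A).trace := by
  have h1 : (((star z ⬝ᵥ A *ᵥ z).re : ℝ) : ℂ) = star z ⬝ᵥ A *ᵥ z :=
    Complex.ext (by simp) (by simpa using (hA.im_star_dotProduct_mulVec_self z).symm)
  have h2 : (((R * A).trace.re : ℝ) : ℂ) = (R * A).trace := by
    refine Complex.conj_eq_iff_re.1 ?_
    rw [← Complex.star_def, ← Matrix.trace_conjTranspose, Matrix.conjTranspose_mul, hR.eq, hA.eq,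
      Matrix.trace_mul_comm]
  rw [centredQuadForm, Complex.ofReal_sub, h1, h2]

lemma IsCircularGaussian.hasAllMoments_centredQuadForm {X : Ω → Fin M → ℂ}
    (hX : IsCircularGaussian X R μ) (A : Matrix (Fin M) (Fin M) ℂ) :
    HasAllMoments (fun o => centredQuadForm R A (X o)) μ := by
  have := hX.gaussian.isProbabilityMeasure
  exact (hX.hasAllMoments_quadForm A).re.sub (.const _)

lemma IsCircularGaussian.integral_centredQuadForm {X : Ω → Fin M → ℂ}
    (hX : IsCircularGaussian X R μ) {A : Matrix (Fin M) (Fin M) ℂ} (hA : A.IsHermitian) :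
    ∫ o, centredQuadForm R A (X o) ∂μ = 0 := by
  have := hX.gaussian.isProbabilityMeasure
  rw [← Complex.ofReal_eq_zero, ← integral_complex_ofReal]
  simp only [ofReal_centredQuadForm hX.isHermitian hA]
  rw [integral_sub (hX.hasAllMoments_quadForm A).integrable (integrable_const _),
    hX.integral_quadForm]
  simp

lemma IsCircularGaussian.integral_centredQuadForm_mul {X : Ω → Fin M → ℂ}
    (hX : IsCircularGaussian X R μ) {A B : Matrix (Fin M) (Fin M) ℂ} (hA : A.IsHermitian)
    (hB : B.IsHermitian) :
    ((∫ o, centredQuadForm R A (X o) * centredQuadForm R B (X o) ∂μ : ℝ) : ℂ) =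
      (R * A * R * B).trace := by
  have := hX.gaussian.isProbabilityMeasure
  have hAm := hX.hasAllMoments_quadForm A
  have hBm := hX.hasAllMoments_quadForm B
  rw [← integral_complex_ofReal]
  simp only [Complex.ofReal_mul, ofReal_centredQuadForm hX.isHermitian hA,
    ofReal_centredQuadForm hX.isHermitian hB]
  have e : ∀ o, (star (X o) ⬝ᵥ A *ᵥ X o - (R * A).trace) * (star (X o) ⬝ᵥ B *ᵥ X o - (R * B).trace)
      = (star (X o) ⬝ᵥ A *ᵥ X o) * (star (X o) ⬝ᵥ B *ᵥ X o) -
        (R * B).trace * (star (X o) ⬝ᵥ A *ᵥ X o) -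
        (R * A).trace * (star (X o) ⬝ᵥ B *ᵥ X o - (R * B).trace) := fun o => by ring
  simp only [e]
  rw [integral_sub ((hAm.mul hBm).sub (hAm.const_mul _)).integrable
      ((hBm.sub (.const _)).const_mul _).integrable,
    integral_sub (hAm.mul hBm).integrable (hAm.const_mul _).integrable, integral_const_mul,
    integral_const_mul, integral_sub hBm.integrable (integrable_const _),
    hX.integral_quadForm_mul_quadForm, hX.integral_quadForm, hX.integral_quadForm]
  simp
  ring

omit [MeasurableSpace Ω] in
lemma isHermitian_sampleCov (N : ℕ) (o : Ω) : (sampleCov x N o).IsHermitian := by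
  ext k l
  simp only [sampleCov, Matrix.conjTranspose_apply, Matrix.smul_apply, Matrix.sum_apply,
    Matrix.vecMulVec_apply, Pi.star_apply, smul_eq_mul, star_mul', star_sum, star_star]
  simp [mul_comm]

omit [MeasurableSpace Ω] in
/-- The weighted inner product of the error of the sample covariance matrix with a Hermitian
matrix is an average of centred quadratic forms of the samples. -/
lemma weightedForm_sampleCov_sub {W G : Matrix (Fin M) (Fin M) ℂ} (hW : W.IsHermitian)
    (hR : R.IsHermitian) (hG : G.IsHermitian) {N : ℕ} (hN : 1 ≤ N) (o : Ω) :
    weightedForm W (sampleCov x N o - R) G =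
      (N : ℝ)⁻¹ * ∑ t ∈ Finset.range N, centredQuadForm R (W * G * W) (x t o) := by
  have hN0 : (N : ℂ) ≠ 0 := by exact_mod_cast (by omega : N ≠ 0)
  have hA : (W * G * W).IsHermitian := by
    simp only [Matrix.IsHermitian, Matrix.conjTranspose_mul, hW.eq, hG.eq, Matrix.mul_assoc]
  have htr : ∀ X, (W * X * W * G).trace = (X * (W * G * W)).trace := fun X => by
    rw [Matrix.mul_assoc, Matrix.mul_assoc, Matrix.trace_mul_comm]
    simp only [Matrix.mul_assoc]
  have hq : ∀ z : Fin M → ℂ, (Matrix.vecMulVec z (star z) * (W * G * W)).trace =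
      star z ⬝ᵥ (W * G * W) *ᵥ z := fun z => by
    rw [Matrix.vecMulVec_mul, Matrix.trace_vecMulVec, dotProduct_comm, Matrix.dotProduct_mulVec]
  rw [← Complex.ofReal_inj, ofReal_weightedForm hW ((isHermitian_sampleCov N o).sub hR) hG, htr,
    Matrix.sub_mul, Matrix.trace_sub, sampleCov, Matrix.smul_mul, Matrix.trace_smul,
    Finset.sum_mul, Matrix.trace_sum]
  push_cast
  simp only [hq, ofReal_centredQuadForm hR hA, Finset.sum_sub_distrib, Finset.sum_const,
    Finset.card_range, nsmul_eq_mul, smul_eq_mul]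
  field_simp

end SampleCov

/-! ### Second moments of linearized estimators -/

section Linearized

variable {Ω : Type*} [MeasurableSpace Ω] {μ : Measure Ω} [IsProbabilityMeasure μ]

/-- If `Y = Z + O(G ^ 2)` and `Z = O(G)`, and likewise for `Y'` and `Z'`, then
`E[Y Y'] = E[Z Z'] + O(E[G ^ 3] + E[G ^ 4])`. When `E[G ^ 4] = O(N ^ (-2))`, the error is
`O(N ^ (-3/2))`. -/
lemma integral_mul_sub_integral_mul_le {Y Y' Z Z' G : Ω → ℝ} (hY : AEMeasurable Y μ)
    (hY' : AEMeasurable Y' μ) (hZ : HasAllMoments Z μ) (hZ' : HasAllMoments Z' μ)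
    (hG : HasAllMoments G μ) (hG0 : ∀ o, 0 ≤ G o) {a : ℝ} (ha : 0 ≤ a)
    (hZG : ∀ o, |Z o| ≤ a * G o) (hZG' : ∀ o, |Z' o| ≤ a * G o)
    (hYZ : ∀ᵐ o ∂μ, |Y o - Z o| ≤ a * G o ^ 2) (hYZ' : ∀ᵐ o ∂μ, |Y' o - Z' o| ≤ a * G o ^ 2)
    {κ : ℝ} {N : ℕ} (hN : 1 ≤ N) (hκ : ∫ o, G o ^ 4 ∂μ ≤ κ / N ^ 2) :
    Integrable (fun o => Y o * Y' o) μ ∧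
      |N * ∫ o, Y o * Y' o ∂μ - N * ∫ o, Z o * Z' o ∂μ| ≤ a ^ 2 * (2 + 3 * κ) / √N := by
  have hN1 : (1 : ℝ) ≤ N := by exact_mod_cast hN
  set c := √(N : ℝ) with hc
  have hc1 : 1 ≤ c := Real.one_le_sqrt.2 hN1
  have hc0 : 0 < c := by linarith
  have hcN : (N : ℝ) = c ^ 2 := (Real.sq_sqrt (by linarith)).symm
  have hκ0 : 0 ≤ κ := by
    have h1 : 0 ≤ κ / N ^ 2 := (integral_nonneg fun o => by positivity).trans hκ
    by_contra! hneg
    have : κ / N ^ 2 < 0 := div_neg_of_neg_of_pos hneg (by positivity)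
    linarith
  have hYG : ∀ {Y Z : Ω → ℝ}, (∀ o, |Z o| ≤ a * G o) → (∀ᵐ o ∂μ, |Y o - Z o| ≤ a * G o ^ 2) →
      ∀ᵐ o ∂μ, |Y o| ≤ a * (G o + G o ^ 2) := by
    intro Y Z h h'
    filter_upwards [h'] with o ho
    have := abs_add_le (Y o - Z o) (Z o)
    rw [sub_add_cancel] at this
    linarith [h o]
  have hGi : ∀ n, Integrable (fun o => G o ^ n) μ := fun n => (hG.pow n).integrable
  have hint : Integrable (fun o => Y o * Y' o) μ := by
    refine Integrable.mono' (((hG.add (hG.pow 2)).pow 2).const_mul (a ^ 2)).integrable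
      (hY.mul hY').aestronglyMeasurable ?_
    filter_upwards [hYG hZG hYZ, hYG hZG' hYZ'] with o h h'
    rw [Real.norm_eq_abs, abs_mul]
    calc |Y o| * |Y' o| ≤ (a * (G o + G o ^ 2)) * (a * (G o + G o ^ 2)) :=
          mul_le_mul h h' (abs_nonneg _) ((abs_nonneg _).trans h)
      _ = _ := by ring
  refine ⟨hint, ?_⟩
  have hdiff : |∫ o, Y o * Y' o ∂μ - ∫ o, Z o * Z' o ∂μ| ≤
      a ^ 2 * (2 * (c ^ 3)⁻¹ + (2 * c + 1) * (κ / N ^ 2)) := by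
    rw [← integral_sub hint (hZ.mul hZ').integrable]
    calc |∫ o, (Y o * Y' o - Z o * Z' o) ∂μ|
        ≤ ∫ o, a ^ 2 * (2 * (c ^ 3)⁻¹ + (2 * c + 1) * G o ^ 4) ∂μ := by
          have hi : Integrable (fun o => a ^ 2 * (2 * (c ^ 3)⁻¹ + (2 * c + 1) * G o ^ 4)) μ :=
            ((integrable_const _).add ((hGi 4).const_mul _)).const_mul _
          rw [← Real.norm_eq_abs]
          refine norm_integral_le_of_norm_le hi ?_
          filter_upwards [hYZ, hYZ', hYG hZG' hYZ'] with o h h' h''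
          have h1 : Y o * Y' o - Z o * Z' o = (Y o - Z o) * Y' o + Z o * (Y' o - Z' o) := by ring
          have hg := hG0 o
          -- The choice `c = √N` balances the two terms of `t³ ≤ c⁻³ + c t⁴`.
          have h3 : G o ^ 3 ≤ (c ^ 3)⁻¹ + c * G o ^ 4 := by
            rcases le_total 1 (c * G o) with hcg | hcg
            · have : 0 ≤ (c ^ 3)⁻¹ := by positivity
              nlinarith [pow_nonneg hg 3, mul_le_mul_of_nonneg_right hcg (pow_nonneg hg 3)]
            · have h5 : (c * G o) ^ 3 ≤ 1 := pow_le_one₀ (by positivity) hcg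
              have h6 : G o ^ 3 ≤ (c ^ 3)⁻¹ := by
                rw [← one_div, le_div_iff₀ (by positivity)]
                linarith [mul_pow c (G o) 3]
              have : 0 ≤ c * G o ^ 4 := by positivity
              linarith
          rw [h1, Real.norm_eq_abs]
          calc |(Y o - Z o) * Y' o + Z o * (Y' o - Z' o)|
              ≤ |Y o - Z o| * |Y' o| + |Z o| * |Y' o - Z' o| := by
                rw [← abs_mul, ← abs_mul]; exact abs_add_le _ _
            _ ≤ (a * G o ^ 2) * (a * (G o + G o ^ 2)) + (a * G o) * (a * G o ^ 2) := by
                gcongr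
                exact hZG o
            _ = a ^ 2 * (2 * G o ^ 3 + G o ^ 4) := by ring
            _ ≤ a ^ 2 * (2 * (c ^ 3)⁻¹ + (2 * c + 1) * G o ^ 4) := by
                refine mul_le_mul_of_nonneg_left ?_ (sq_nonneg a)
                linarith
      _ = a ^ 2 * (2 * (c ^ 3)⁻¹ + (2 * c + 1) * ∫ o, G o ^ 4 ∂μ) := by
          rw [integral_const_mul, integral_add (integrable_const _) ((hGi 4).const_mul _),
            integral_const_mul (2 * c + 1)]
          simp
      _ ≤ _ := by gcongr
  rw [← mul_sub, abs_mul, abs_of_nonneg (by linarith : (0 : ℝ) ≤ N)]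
  calc (N : ℝ) * |∫ o, Y o * Y' o ∂μ - ∫ o, Z o * Z' o ∂μ|
      ≤ N * (a ^ 2 * (2 * (c ^ 3)⁻¹ + (2 * c + 1) * (κ / N ^ 2))) := by gcongr
    _ = a ^ 2 * ((2 + 2 * κ) / c + κ / c ^ 2) := by
        rw [hcN]; field_simp; ring
    _ ≤ a ^ 2 * ((2 + 2 * κ) / c + κ / c) := by
        gcongr
        exact le_self_pow₀ hc1 two_ne_zero
    _ = _ := by ring

end Linearized

section Gradient

open scoped Matrix.Norms.Elementwise

variable {M D : ℕ} {u : Fin M → ℝ} {W R : Matrix (Fin M) (Fin M) ℂ}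

lemma exists_abs_weightedForm_le (G : Matrix (Fin M) (Fin M) ℂ) :
    ∃ b : ℝ, 0 ≤ b ∧ ∀ X, |weightedForm W X G| ≤ b * ∑ k, ∑ l, ‖X k l‖ := by
  obtain ⟨b, hb, hbX⟩ := ((weightedForm W).flip G).bound
  exact ⟨b, hb.le, fun X => (hbX X).trans (by gcongr; exact norm_le_sum_norm X)⟩

/-- At an interior minimizer of the limiting cost, the gradient of the cost is linear in the
error of the data. -/
lemma partialDeriv_cost_eq_neg_weightedForm (hW : W.IsHermitian) {K : Set ℝ} {θ₀ : Param D → ℝ}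
    (hint : θ₀ .omega ∈ interior K) (hmin : IsMinOn (cost u W R) (searchDomain D K) θ₀)
    (C : Matrix (Fin M) (Fin M) ℂ) (k : Param D) :
    partialDeriv k (cost u W C) θ₀ = -weightedForm W (C - R) (covModelD u k θ₀) := by
  have hproj : Continuous fun θ : Param D → ℝ => θ .omega := continuous_apply _
  have hloc : IsLocalMin (cost u W R) θ₀ := hmin.isLocalMin
    (mem_of_superset ((isOpen_interior.preimage hproj).mem_nhds hint)
      (Set.preimage_mono interior_subset))
  have hd : DifferentiableAt ℝ (cost u W R) θ₀ := by
    rw [cost_eq_lsCost]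
    exact (hasFDerivAt_lsCost (weightedForm_comm hW) differentiable_covModel R θ₀).differentiableAt
  have h0 : partialDeriv k (cost u W R) θ₀ = 0 := by
    rw [partialDeriv_eq_fderiv hd, hloc.fderiv_eq_zero]; rfl
  rw [partialDeriv_cost hW, neg_eq_zero] at h0
  have h1 : C - covModel u θ₀ = (C - R) + (R - covModel u θ₀) := by abel
  rw [partialDeriv_cost hW, h1, map_add, _root_.add_apply, h0, add_zero]

end Gradient

/-- The exact covariance of the linear statistics of the sample covariance matrix. -/
lemma natCast_mul_integral_weightedForm_mul {M : ℕ} {Ω : Type*} [MeasurableSpace Ω]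
    {μ : Measure Ω} {W R G G' : Matrix (Fin M) (Fin M) ℂ} (hW : W.IsHermitian)
    (hG : G.IsHermitian) (hG' : G'.IsHermitian) {x : ℕ → Ω → Fin M → ℂ} (hindep : iIndepFun x μ)
    (hgauss : ∀ t, IsCircularGaussian (x t) R μ) {N : ℕ} (hN : 1 ≤ N) :
    (N : ℝ) * ∫ o, weightedForm W (sampleCov x N o - R) G *
        weightedForm W (sampleCov x N o - R) G' ∂μ = (W * G * W * R * W * G' * W * R).trace.re := by
  have hR := (hgauss 0).isHermitian
  have hN0 : (N : ℝ) ≠ 0 := by exact_mod_cast (by omega : N ≠ 0)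
  have hA : ∀ {G : Matrix (Fin M) (Fin M) ℂ}, G.IsHermitian → (W * G * W).IsHermitian := by
    intro G hG
    simp only [Matrix.IsHermitian, Matrix.conjTranspose_mul, hW.eq, hG.eq, Matrix.mul_assoc]
  have hc : ∀ t, ∫ o, centredQuadForm R (W * G * W) (x t o) *
      centredQuadForm R (W * G' * W) (x t o) ∂μ = (W * G * W * R * W * G' * W * R).trace.re := by
    intro t
    rw [← Complex.ofReal_re (∫ o, _ ∂μ), (hgauss t).integral_centredQuadForm_mul (hA hG) (hA hG')]
    rw [Matrix.mul_assoc R, Matrix.mul_assoc R, Matrix.trace_mul_comm]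
    simp only [Matrix.mul_assoc]
  have h := integral_sum_mul_sum hindep (measurable_centredQuadForm R (W * G * W))
    (measurable_centredQuadForm R (W * G' * W))
    (fun t => (hgauss t).hasAllMoments_centredQuadForm _)
    (fun t => (hgauss t).hasAllMoments_centredQuadForm _)
    (fun t => (hgauss t).integral_centredQuadForm (hA hG)) hc N
  simp only [weightedForm_sampleCov_sub hW hR hG hN, weightedForm_sampleCov_sub hW hR hG' hN,
    mul_mul_mul_comm (N : ℝ)⁻¹]
  rw [integral_const_mul, h]
  field_simp

lemma hasAllMoments_weightedForm_sampleCov {M : ℕ} {Ω : Type*} [MeasurableSpace Ω]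
    {μ : Measure Ω} {W R G : Matrix (Fin M) (Fin M) ℂ} (hW : W.IsHermitian) (hG : G.IsHermitian)
    {x : ℕ → Ω → Fin M → ℂ} (hgauss : ∀ t, IsCircularGaussian (x t) R μ) {N : ℕ} (hN : 1 ≤ N) :
    HasAllMoments (fun o => weightedForm W (sampleCov x N o - R) G) μ := by
  simp only [weightedForm_sampleCov_sub hW (hgauss 0).isHermitian hG hN]
  exact (HasAllMoments.sum _ fun t _ => (hgauss t).hasAllMoments_centredQuadForm _).const_mul _

end MoMET

/-! ### Asymptotic covariance -/

/-- Asymptotic covariance of the moment-matching estimator. -/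
theorem mainTheorem4 {M D : ℕ} {Ω : Type*} [MeasurableSpace Ω]
    (μ : Measure Ω) [IsProbabilityMeasure μ]
    -- array, source power density, noise level, weight, true covariance
    (u : Fin M → ℝ) (f : ℝ → ℝ) (hf : Integrable f) (hf0 : ∀ ω, 0 ≤ f ω) (σε : ℝ)
    (W : Matrix (Fin M) (Fin M) ℂ) (hW : W.PosDef)
    (R : Matrix (Fin M) (Fin M) ℂ) (hR : R = trueCov u f σε)
    -- the measurements are i.i.d. circular Gaussian with covariance `R`
    (x : ℕ → Ω → Fin M → ℂ) (hindep : iIndepFun x μ)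
    (hgauss : ∀ t, IsCircularGaussian (x t) R μ)
    -- `θ₀` is the unique global minimizer of `J_∞`, it is interior and nondegenerate
    (K : Set ℝ) (hK : IsCompact K) (θ₀ : Param D → ℝ)
    (hθ₀int : θ₀ .omega ∈ interior K)
    (hθ₀min : IsMinOn (cost u W R) (searchDomain D K) θ₀)
    (hθ₀uniq : ∀ θ ∈ searchDomain D K, cost u W R θ = cost u W R θ₀ → θ = θ₀)
    (H : Matrix (Param D) (Param D) ℝ) (hH : H = hessian (cost u W R) θ₀)
    (hHinv : IsUnit H.det)
    -- `θhat N` is the estimator computed from the first `N` samples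
    (θhat : ℕ → Ω → Param D → ℝ) (hmeas : ∀ N, AEMeasurable (θhat N) μ)
    (hmin : ∀ N, 1 ≤ N → ∀ᵐ o ∂μ, θhat N o ∈ searchDomain D K ∧
      IsMinOn (cost u W (sampleCov x N o)) (searchDomain D K) (θhat N o)) :
    -- trace formula for the Hessian of `J_∞` at `θ₀`
    (∀ k l, ((H k l : ℝ) : ℂ) =
      (W * covModelD2 u k l θ₀ * W * (covModel u θ₀ - R)).trace +
      (W * covModelD u k θ₀ * W * covModelD u l θ₀).trace) ∧
    -- fourth-moment identity
    (∀ t, ∀ A B : Matrix (Fin M) (Fin M) ℂ,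
      Integrable (fun o => (star (x t o) ⬝ᵥ A *ᵥ x t o) * (star (x t o) ⬝ᵥ B *ᵥ x t o)) μ ∧
      ∫ o, (star (x t o) ⬝ᵥ A *ᵥ x t o) * (star (x t o) ⬝ᵥ B *ᵥ x t o) ∂μ =
        (R * A).trace * (R * B).trace + (R * A * R * B).trace) ∧
    -- the limit `C₀` of `N E[∇J_N(θ₀) ∇J_N(θ₀)ᵀ]`, and its trace formula
    ∃ C₀ : Matrix (Param D) (Param D) ℝ,
      (∀ N, 1 ≤ N → ∀ k l, Integrable (fun o =>
        partialDeriv k (cost u W (sampleCov x N o)) θ₀ *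
        partialDeriv l (cost u W (sampleCov x N o)) θ₀) μ) ∧
      (∀ k l, Tendsto (fun N : ℕ => (N : ℝ) * ∫ o,
        partialDeriv k (cost u W (sampleCov x N o)) θ₀ *
        partialDeriv l (cost u W (sampleCov x N o)) θ₀ ∂μ) atTop (𝓝 (C₀ k l))) ∧
      (∀ k l, ((C₀ k l : ℝ) : ℂ) =
        (W * covModelD u k θ₀ * W * R * W * covModelD u l θ₀ * W * R).trace) ∧
      -- `C_N = E[(θhat N - θ₀)(θhat N - θ₀)ᵀ]` satisfies `N C_N → H⁻¹ C₀ H⁻¹`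
      (∀ N, 1 ≤ N → ∀ k l, Integrable (fun o =>
        (θhat N o k - θ₀ k) * (θhat N o l - θ₀ l)) μ) ∧
      (∀ k l, Tendsto (fun N : ℕ => (N : ℝ) * ∫ o,
        (θhat N o k - θ₀ k) * (θhat N o l - θ₀ l) ∂μ) atTop
        (𝓝 ((H⁻¹ * C₀ * H⁻¹) k l))) := by
  have hWh := hW.isHermitian
  have hRh := (hgauss 0).isHermitian
  have hD : ∀ k, (covModelD u k θ₀).IsHermitian := fun k => isHermitian_covModelD k θ₀
  set L : Param D → ℕ → Ω → ℝ := fun k N o =>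
    weightedForm W (sampleCov x N o - R) (covModelD u k θ₀) with hL
  set C₀ : Matrix (Param D) (Param D) ℝ := Matrix.of fun k l =>
    (W * covModelD u k θ₀ * W * R * W * covModelD u l θ₀ * W * R).trace.re with hC₀
  have hLm : ∀ N, 1 ≤ N → ∀ k, HasAllMoments (L k N) μ := fun N hN k =>
    hasAllMoments_weightedForm_sampleCov hWh (hD k) hgauss hN
  have hLcov : ∀ N : ℕ, 1 ≤ N → ∀ k l, (N : ℝ) * ∫ o, L k N o * L l N o ∂μ = C₀ k l :=
    fun N hN k l => natCast_mul_integral_weightedForm_mul hWh (hD k) (hD l) hindep hgauss hN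
  have hgrad : ∀ N k o, partialDeriv k (cost u W (sampleCov x N o)) θ₀ = -L k N o :=
    fun N k o => partialDeriv_cost_eq_neg_weightedForm hWh hθ₀int hθ₀min _ k
  refine ⟨fun k l => by rw [hH]; exact ofReal_hessian_cost hWh hRh θ₀ k l,
    fun t A B => ⟨(((hgauss t).hasAllMoments_quadForm A).mul
      ((hgauss t).hasAllMoments_quadForm B)).integrable,
      (hgauss t).integral_quadForm_mul_quadForm A B⟩, C₀, ?_, ?_, ?_, ?_⟩
  · intro N hN k l
    simp only [hgrad, neg_mul_neg]
    exact ((hLm N hN k).mul (hLm N hN l)).integrable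
  · intro k l
    refine tendsto_const_nhds.congr' ?_
    filter_upwards [eventually_ge_atTop 1] with N hN
    simp only [hgrad, neg_mul_neg, hLcov N hN]
  · intro k l
    have hA : ∀ k, (W * covModelD u k θ₀ * W).IsHermitian := fun k => by
      simp only [Matrix.IsHermitian, Matrix.conjTranspose_mul, hWh.eq, (hD k).eq, Matrix.mul_assoc]
    have h := (hgauss 0).integral_centredQuadForm_mul (hA k) (hA l)
    have htr : (R * (W * covModelD u k θ₀ * W) * R * (W * covModelD u l θ₀ * W)).trace =
        (W * covModelD u k θ₀ * W * R * W * covModelD u l θ₀ * W * R).trace := by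
      rw [Matrix.mul_assoc R, Matrix.mul_assoc R, Matrix.trace_mul_comm]
      simp only [Matrix.mul_assoc]
    rw [htr] at h
    rw [hC₀, Matrix.of_apply, ← h, Complex.ofReal_re]
  -- `Z k N o` is the `k`-th coordinate of the linearized estimation error.
  set Z : Param D → ℕ → Ω → ℝ := fun k N o => ∑ j, H⁻¹ k j * L j N o with hZ
  set G : ℕ → Ω → ℝ := fun N o => ∑ k, ∑ l, ‖(sampleCov x N o - R) k l‖ with hG
  have hG0 : ∀ N o, 0 ≤ G N o := fun N o => by positivity
  have hGm : ∀ N, 1 ≤ N → HasAllMoments (G N) μ := fun N hN =>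
    .sum _ fun k _ => .sum _ fun l _ => (hasAllMoments_sampleCov_sub hgauss hN k l).norm
  have hZm : ∀ N, 1 ≤ N → ∀ k, HasAllMoments (Z k N) μ := fun N hN k =>
    .sum _ fun j _ => (hLm N hN j).const_mul _
  obtain ⟨κ, hκ⟩ := exists_integral_sum_norm_sampleCov_sub_pow_four_le hindep hgauss
  obtain ⟨C, hC, hlin⟩ := exists_abs_estimator_sub_le hW hK hθ₀int hθ₀min hθ₀uniq (hH ▸ hHinv)
  choose b hb hbL using fun k => exists_abs_weightedForm_le (W := W) (covModelD u k θ₀)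
  set a := C + ∑ k, ∑ j, |H⁻¹ k j| * b j with ha
  have hb0 : ∀ k j, 0 ≤ |H⁻¹ k j| * b j := fun k j => mul_nonneg (abs_nonneg _) (hb j)
  have hsum0 : ∀ k, 0 ≤ ∑ j, |H⁻¹ k j| * b j := fun k => Finset.sum_nonneg fun j _ => hb0 k j
  have ha0 : 0 ≤ a := add_nonneg hC (Finset.sum_nonneg fun k _ => hsum0 k)
  have hZG : ∀ N k o, |Z k N o| ≤ a * G N o := by
    intro N k o
    calc |Z k N o| ≤ ∑ j, |H⁻¹ k j * L j N o| := Finset.abs_sum_le_sum_abs _ _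
      _ ≤ ∑ j, |H⁻¹ k j| * b j * G N o := Finset.sum_le_sum fun j _ => by
          rw [abs_mul, mul_assoc]
          gcongr
          exact hbL j _
      _ = (∑ j, |H⁻¹ k j| * b j) * G N o := by rw [Finset.sum_mul]
      _ ≤ a * G N o := by
          have := hG0 N o
          gcongr
          have := Finset.single_le_sum (f := fun k => ∑ j, |H⁻¹ k j| * b j)
            (fun k _ => hsum0 k) (Finset.mem_univ k)
          linarith
  have hYZ : ∀ N, 1 ≤ N → ∀ k, ∀ᵐ o ∂μ,
      |(θhat N o k - θ₀ k) - Z k N o| ≤ a * G N o ^ 2 := by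
    intro N hN k
    filter_upwards [hmin N hN] with o ho
    have hmin' := ho.2
    rw [← add_sub_cancel R (sampleCov x N o)] at hmin'
    have h := hlin (sampleCov x N o - R) (θhat N o) ho.1 hmin' k
    rw [← hH] at h
    refine h.trans ?_
    gcongr
    rw [ha]
    exact le_add_of_nonneg_right (Finset.sum_nonneg fun k _ => hsum0 k)
  have hYm : ∀ N k, AEMeasurable (fun o => θhat N o k - θ₀ k) μ := fun N k =>
    ((measurable_pi_apply k).comp_aemeasurable (hmeas N)).sub_const _
  have hmain := fun N hN k l => integral_mul_sub_integral_mul_le (hYm N k) (hYm N l) (hZm N hN k)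
    (hZm N hN l) (hGm N hN) (hG0 N) ha0 (hZG N k) (hZG N l) (hYZ N hN k) (hYZ N hN l) hN (hκ N hN)
  refine ⟨fun N hN k l => (hmain N hN k l).1, fun k l => ?_⟩
  have hHsymm : (H⁻¹)ᵀ = H⁻¹ := by
    rw [Matrix.transpose_nonsing_inv, hH, hessian_cost_symm hWh]
  have hZcov : ∀ N : ℕ, 1 ≤ N → (N : ℝ) * ∫ o, Z k N o * Z l N o ∂μ = (H⁻¹ * C₀ * H⁻¹) k l := by
    intro N hN
    have hi : ∀ i j, Integrable (fun o => H⁻¹ k i * H⁻¹ l j * (L i N o * L j N o)) μ := fun i j =>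
      (((hLm N hN i).mul (hLm N hN j)).const_mul _).integrable
    have e : ∀ o, Z k N o * Z l N o = ∑ j, ∑ i, H⁻¹ k i * H⁻¹ l j * (L i N o * L j N o) := by
      intro o
      rw [Finset.sum_comm]
      simp only [hZ, Finset.sum_mul_sum]
      refine Finset.sum_congr rfl fun i _ => Finset.sum_congr rfl fun j _ => ?_
      ring
    simp only [e]
    rw [integral_finsetSum _ fun j _ => integrable_finsetSum _ fun i _ => hi i j, Finset.mul_sum,
      Matrix.mul_apply]
    refine Finset.sum_congr rfl fun j _ => ?_
    rw [integral_finsetSum _ fun i _ => hi i j, Finset.mul_sum, Matrix.mul_apply, Finset.sum_mul]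
    refine Finset.sum_congr rfl fun i _ => ?_
    rw [integral_const_mul, ← hLcov N hN i j, ← congrFun (congrFun hHsymm j) l,
      Matrix.transpose_apply]
    ring
  have hzero : Tendsto (fun N : ℕ => a ^ 2 * (2 + 3 * κ) / √(N : ℝ)) atTop (𝓝 0) :=
    tendsto_const_nhds.div_atTop (Real.tendsto_sqrt_atTop.comp tendsto_natCast_atTop_atTop)
  refine tendsto_iff_norm_sub_tendsto_zero.2 (squeeze_zero' (Eventually.of_forall fun N =>
    norm_nonneg _) ?_ hzero)
  filter_upwards [eventually_ge_atTop 1] with N hN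
  rw [← hZcov N hN]
  exact (hmain N hN k l).2
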